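/- Let $d \ge 1$ and let $D$ be a finite subset of $\mathbb{Z}^d$ with $n$ points. Let $\hat D$ be the finite multigraph obtained from $D$ by wiring its boundary: its vertex set is $D \cup \{x_0\}$, where $x_0$ is one abstract point obtained by contracting all points of $\partial D$ (the points outside $D$ that have a nearest neighbour in $D$), and its edges are the nearest-neighbour edges of $\mathbb{Z}^d$ having at least one end-point in $D$, an edge from $x\in D$ to a point of $\partial D$ becoming an edge from $x$ to $x_0$ (so that several edges may join $x$ to $x_0$). A spanning tree of $\hat D$ is a set $T$ of edges of $\hat D$ such that the graph with vertex set $D\cup\{x_0\}$ and edge set $T$ is connected and contains no cycle. Let $\Delta_D$ be the $n\times n$ matrix of the discrete Laplacian $\Delta f(x) = \frac{1}{2d}\sum_{y\sim x} f(y) - f(x)$ acting on the functions on $\mathbb{Z}^d$ that vanish outside $D$. The loop-erasure of a finite path $(z_0,\dots,z_m)$ is the path $(L_0,\dots,L_\sigma)$ with $L_0=z_0$, $L_{j+1}=z_{1+r_j}$ where $r_j=\max\{r\le m: z_r=L_j\}$, and $\sigma=\min\{j: L_j=z_m\}$. Wilson's algorithm in $D$ is the following. Order the points of $D$ arbitrarily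 as $x_1,\dots,x_n$, let $Z^1, \dots, Z^n$ be independent simple random walks on $\mathbb{Z}^d$ started from $x_1, \dots, x_n$ respectively, and let $X^{(0)}=\emptyset$. For $k=1,\dots,n$: if $x_k\in X^{(k-1)}$, set $X^{(k)}=X^{(k-1)}$; otherwise stop $Z^k$ at its first exit from $D\setminus X^{(k-1)}$, and let $X^{(k)}$ be the union of $X^{(k-1)}$ with the sites visited and the edges used by the loop-erasure of this stopped walk. Let $\mathcal{T}$ be the set of edges of $\hat D$ corresponding to the edges of $X^{(n)}$. Then: 1. Almost surely, all the walks exit $D$ in finite time (so that the algorithm is well defined), and, whatever the ordering of $D$, the law of $\mathcal{T}$ is the uniform distribution on the set of all spanning trees of $\hat D$. 2. The number of spanning trees of $\hat D$ is equal to $(2d)^n \det(-\Delta_D)$. -/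

import Mathlib

open MeasureTheory ProbabilityTheory

namespace WilsonUST

/-! ### The lattice `ℤ^d` and the Dirichlet Laplacian -/

/-- The `2d` unit vectors `±e_i` of `ℤ^d`. -/
def unitSteps (d : ℕ) : Finset (Fin d → ℤ) :=
  (Finset.univ.image fun i : Fin d => (Pi.single i 1 : Fin d → ℤ)) ∪
    (Finset.univ.image fun i : Fin d => (Pi.single i (-1) : Fin d → ℤ))

/-- Nearest-neighbour relation on `ℤ^d`. -/
def Nbr {d : ℕ} (x y : Fin d → ℤ) : Prop := y - x ∈ unitSteps d

theorem Nbr.symm {d : ℕ} {x y : Fin d → ℤ} (h : Nbr x y) : Nbr y x := by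
  unfold Nbr unitSteps at *
  rw [← neg_sub y x]
  simp only [Finset.mem_union, Finset.mem_image, Finset.mem_univ, true_and] at h ⊢
  rcases h with ⟨i, hi⟩ | ⟨i, hi⟩
  · exact Or.inr ⟨i, by rw [← hi, Pi.single_neg]⟩
  · exact Or.inl ⟨i, by rw [← hi, Pi.single_neg, neg_neg]⟩

/-- The discrete Laplacian, normalised as `Δ f (x) = (mean of f over the 2d neighbours of x) - f x`. -/
noncomputable def laplacian {d : ℕ} (f : (Fin d → ℤ) → ℝ) (x : Fin d → ℤ) : ℝ :=
  ((2 * (d : ℝ))⁻¹ * ∑ v ∈ unitSteps d, f (x + v)) - f x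

/-- The matrix `(Δ_D(x, y))_{x, y ∈ D}` of the Laplacian acting on functions that vanish
outside `D`: the entry at `(x, y)` is the Laplacian at `x` of the indicator function of `y`. -/
noncomputable def dirichletLaplacian {d : ℕ} (D : Finset (Fin d → ℤ)) : Matrix D D ℝ :=
  Matrix.of fun x y => laplacian (Pi.single (y : Fin d → ℤ) (1 : ℝ)) (x : Fin d → ℤ)

/-! ### Spanning trees of multigraphs -/

/-- `IsWalk G x w y`: the list of edges `w` is that of a walk from `x` to `y` in the
multigraph `G`. -/
inductive IsWalk {α β : Type*} (G : Graph α β) : α → List β → α → Prop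
  | nil {x : α} (hx : x ∈ G.vertexSet) : IsWalk G x [] x
  | cons {e : β} {x y z : α} {w : List β} (he : G.IsLink e x y) (hw : IsWalk G y w z) :
      IsWalk G x (e :: w) z

/-- A multigraph is connected if it has a vertex and any two vertices are joined by a walk. -/
def IsConnected {α β : Type*} (G : Graph α β) : Prop :=
  G.vertexSet.Nonempty ∧ ∀ x ∈ G.vertexSet, ∀ y ∈ G.vertexSet, ∃ w, IsWalk G x w y

/-- A multigraph has no cycle: there is no non-trivial closed walk using each of its edges
only once (so a loop, or two parallel edges, form a cycle). -/
def IsAcyclic {α β : Type*} (G : Graph α β) : Prop :=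
  ¬ ∃ (x : α) (w : List β), w ≠ [] ∧ w.Nodup ∧ IsWalk G x w x

/-- The set of spanning trees of a multigraph `G`, a spanning tree being a set `T` of edges such
that the graph with all the vertices of `G` and edge set `T` is connected and has no cycle. -/
def spanningTrees {α β : Type*} (G : Graph α β) : Set (Set β) :=
  {T | T ⊆ G.edgeSet ∧ IsConnected (G.restrict T) ∧ IsAcyclic (G.restrict T)}

/-! ### The wired graph `D̂` -/

/-- The contraction map: a point of `D` is kept, all the points outside `D` become the single
abstract point `x₀ = none`. -/
def contract {d : ℕ} (D : Finset (Fin d → ℤ)) (x : Fin d → ℤ) : Option D :=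
  if h : x ∈ D then some ⟨x, h⟩ else none

/-- The graph `D̂`, with vertex set `D ∪ {x₀}`. Its edges are the edges `{x, y}` of `ℤ^d` with at
least one end-point in `D`, and such an edge joins in `D̂` the images of `x` and `y` under the
contraction. Thus a point of `D` may be joined to `x₀` by several edges, and the bijection `φ`
between the edges of `ℤ^d` touching `D` and the edges of `D̂` is the identity. -/
def wiredGraph {d : ℕ} (D : Finset (Fin d → ℤ)) : Graph (Option D) (Sym2 (Fin d → ℤ)) where
  vertexSet := Set.univ
  IsLink e a b := ∃ x y : Fin d → ℤ,
    e = s(x, y) ∧ Nbr x y ∧ (x ∈ D ∨ y ∈ D) ∧ contract D x = a ∧ contract D y = b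
  isLink_symm := by
    rintro e -
    refine ⟨?_⟩
    rintro a b ⟨x, y, he, hxy, hD, ha, hb⟩
    exact ⟨y, x, he.trans Sym2.eq_swap, hxy.symm, hD.symm, hb, ha⟩
  eq_or_eq_of_isLink_of_isLink := by
    rintro e a b a' b' ⟨x, y, rfl, -, -, rfl, rfl⟩ ⟨x', y', h, -, -, rfl, rfl⟩
    rcases Sym2.eq_iff.1 h with ⟨rfl, rfl⟩ | ⟨rfl, rfl⟩
    · exact Or.inl rfl
    · exact Or.inr rfl
  left_mem_of_isLink := fun _ _ _ _ => Set.mem_univ _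

/-! ### Loop-erasure of the path `(z 0, …, z m)` -/

/-- The last time `r ≤ m` at which the path `z` is at `v`. -/
def lastVisit {V : Type*} [DecidableEq V] (z : ℕ → V) (m : ℕ) (v : V) : ℕ :=
  Nat.findGreatest (fun r => z r = v) m

/-- The sequence `L_0 = z_0`, `L_{j+1} = z_{1 + r_j}` with `r_j = max {r ≤ m : z_r = L_j}`
(relevant only up to the index `loopErasureLength z m`). -/
def loopErasure {V : Type*} [DecidableEq V] (z : ℕ → V) (m : ℕ) : ℕ → V
  | 0 => z 0
  | j + 1 => z (1 + lastVisit z m (loopErasure z m j))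

/-- The number of steps `σ = min {j : L_j = z_m}` of the loop-erasure. -/
noncomputable def loopErasureLength {V : Type*} [DecidableEq V] (z : ℕ → V) (m : ℕ) : ℕ :=
  sInf {j | loopErasure z m j = z m}

/-- A set of sites together with a set of edges. -/
structure Explored (V : Type*) where
  verts : Set V
  edges : Set (Sym2 V)

/-- The sites visited by the loop-erasure of `(z 0, …, z m)`, together with the edges along which
it jumps. -/
def loopErasurePath {V : Type*} [DecidableEq V] (z : ℕ → V) (m : ℕ) : Explored V where
  verts := {v | ∃ j ≤ loopErasureLength z m, v = loopErasure z m j}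
  edges := {e | ∃ j < loopErasureLength z m, e = s(loopErasure z m j, loopErasure z m (j + 1))}

/-! ### Wilson's algorithm -/

/-- The first exit time of the path `z` from the set `A`. -/
noncomputable def exitTime {V : Type*} (A : Set V) (z : ℕ → V) : ℕ := sInf {r | z r ∉ A}

open Classical in
/-- One step of Wilson's algorithm: if the point `x` already belongs to `X`, nothing happens.
Otherwise, the walk `z` (started from `x`) is stopped at its first exit from `D \ X` and its
loop-erasure is added to `X`. -/
noncomputable def wilsonStep {V : Type*} [DecidableEq V] (D : Finset V) (x : V) (z : ℕ → V)
    (X : Explored V) : Explored V :=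
  if x ∈ X.verts then X
  else
    let L := loopErasurePath z (exitTime ((D : Set V) \ X.verts) z)
    ⟨X.verts ∪ L.verts, X.edges ∪ L.edges⟩

/-- The successive stages `X^{(0)} = ∅, X^{(1)}, …, X^{(n)}` of Wilson's algorithm in `D`, for the
ordering `x` of the points of `D`, and where `z k` is the walk started from `x k`. -/
noncomputable def wilsonStages {V : Type*} [DecidableEq V] (D : Finset V) {n : ℕ}
    (x : Fin n → V) (z : Fin n → ℕ → V) : Fin (n + 1) → Explored V :=
  Fin.induction ⟨∅, ∅⟩ fun k X => wilsonStep D (x k) (z k) X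

/-- The set of edges produced by Wilson's algorithm, i.e. those of `X^{(n)}`. -/
noncomputable def wilsonTree {V : Type*} [DecidableEq V] (D : Finset V) {n : ℕ}
    (x : Fin n → V) (z : Fin n → ℕ → V) : Set (Sym2 V) :=
  (wilsonStages D x z (Fin.last n)).edges

/-- `Z` is a simple random walk on `ℤ^d` started from `x`: its increments are independent and
uniformly distributed on the `2d` unit vectors. -/
structure IsSimpleRandomWalk {d : ℕ} {Ω : Type*} [MeasurableSpace Ω] (P : Measure Ω)
    (x : Fin d → ℤ) (Z : ℕ → Ω → (Fin d → ℤ)) : Prop where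
  measurable : ∀ r, Measurable (Z r)
  start : ∀ᵐ ω ∂P, Z 0 ω = x
  indep : iIndepFun (fun r ω => Z (r + 1) ω - Z r ω) P
  step : ∀ r, HasLaw (fun ω => Z (r + 1) ω - Z r ω) (uniformOn (unitSteps d : Set (Fin d → ℤ))) P

end WilsonUST

/-! Orient each spanning tree towards `x₀`: it becomes a parent map, sending each point of `D` to a
neighbour and having iterates that leave `D`. This correspondence is one-to-one on edge sets
(`exists_isParentMap_of_mem_spanningTrees`, `IsParentMap.eqOn_of_parentEdges_eq`). Once the walks
leave `D`, Wilson's algorithm outputs the edges of a parent map, and it outputs those of `f` exactly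
when each loop-erasure runs along the orbit of its starting point under `f` up to the explored part
(`Follows`, `wilsonRun_edges_eq_iff`).

For fixed `f` and a fixed ordering, the explored part at each stage is deterministic on this event.
The event is therefore a box in the independent walks, and its probability is a product. If `A` is
the unexplored part and `O` the portion of orbit to be added, the corresponding factor is
`treeWeight D (A \ O) / treeWeight D A`, where `treeWeight` is `(2d)^|A| det(-Δ_A)`
(`pathLaw_real_exitsAlong`). The product telescopes to `(treeWeight D D)⁻¹`, which depends neither
on `f` nor on the ordering. Hence the law is uniform, and total mass one gives the number of trees.

The factor is computed one point of the orbit at a time. Let `e u` be the probability that a walk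
from `u` leaves `A` along the chain that starts at `y`. A first-step analysis shows that `e`
vanishes off `A` and that `-Δe` is `p/(2d)` at `y` and zero elsewhere on `A`, where `p` is the
probability of the rest of the chain in `A \ {y}`. Cramer's rule then expresses `e y` as `p/(2d)`
times a ratio of determinants.

A maximum principle (`eq_zero_of_laplacian_eq_zero`) yields both the nonvanishing of these
determinants and the almost sure exit from `D`. -/

namespace WilsonUST

/-! ### Walks in multigraphs -/

section Walks

variable {α β : Type*} {G : Graph α β} {x y z : α} {e : β} {w w' : List β}

theorem restrict_isLink_iff {T : Set β} :
    (G.restrict T).IsLink e x y ↔ e ∈ T ∧ G.IsLink e x y :=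
  iff_of_eq (Graph.restrict_isLink G T e x y)

theorem IsWalk.append (h : IsWalk G x w y) (h' : IsWalk G y w' z) : IsWalk G x (w ++ w') z := by
  induction h with
  | nil _ => exact h'
  | cons he _ ih => exact .cons he (ih h')

theorem IsWalk.reverse (h : IsWalk G x w y) : ∃ w', IsWalk G y w' x := by
  induction h with
  | nil hx => exact ⟨[], .nil hx⟩
  | cons he _ ih =>
    obtain ⟨w', hw'⟩ := ih
    exact ⟨_, hw'.append (.cons he.symm (.nil he.left_mem))⟩

theorem IsWalk.mono {H : Graph α β} (hV : G.vertexSet ⊆ H.vertexSet)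
    (hL : ∀ e a b, G.IsLink e a b → H.IsLink e a b) (h : IsWalk G x w y) : IsWalk H x w y := by
  induction h with
  | nil hx => exact .nil (hV hx)
  | cons he _ ih => exact .cons (hL _ _ _ he) ih

/-- The part of a walk that starts with a given edge of it. -/
theorem IsWalk.exists_suffix (h : IsWalk G x w y) (he : e ∈ w) :
    ∃ u v w', G.IsLink e u v ∧ IsWalk G v w' y ∧ (e :: w') <:+ w := by
  induction h with
  | nil hx => simp at he
  | cons hl hw ih =>
    rcases List.mem_cons.1 he with rfl | he
    · exact ⟨_, _, _, hl, hw, List.suffix_rfl⟩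
    · obtain ⟨u, v, w', h1, h2, h3⟩ := ih he
      exact ⟨u, v, w', h1, h2, h3.trans (List.suffix_cons _ _)⟩

/-- Two vertices joined by a walk are joined by a walk that uses each of its edges once. -/
theorem IsWalk.exists_nodup (h : IsWalk G x w y) : ∃ w', w'.Nodup ∧ IsWalk G x w' y := by
  induction h with
  | nil hx => exact ⟨[], List.nodup_nil, .nil hx⟩
  | @cons e x x' y w hl hw ih =>
    obtain ⟨w', hn, hw'⟩ := ih
    by_cases he : e ∈ w'
    · obtain ⟨u, v, w2, h1, h2, h3⟩ := hw'.exists_suffix he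
      have hn2 := hn.sublist h3.sublist
      -- The later passage through `e` has the same direction as the first one or the opposite
      -- direction; cut just before it or just after it accordingly.
      rcases hl.eq_and_eq_or_eq_and_eq h1 with ⟨rfl, rfl⟩ | ⟨rfl, rfl⟩
      · exact ⟨_, hn2, .cons h1 h2⟩
      · exact ⟨_, (List.nodup_cons.1 hn2).2, h2⟩
    · exact ⟨e :: w', List.nodup_cons.2 ⟨he, hn⟩, .cons hl hw'⟩

/-- A walk whose edges preserve a set of vertices stays in this set. -/
theorem IsWalk.mem_of_forall {S : Set α} (h : IsWalk G x w y)
    (hS : ∀ e ∈ w, ∀ a b, G.IsLink e a b → a ∈ S → b ∈ S) (hx : x ∈ S) : y ∈ S := by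
  induction h with
  | nil _ => exact hx
  | cons hl _ ih =>
    exact ih (fun e he => hS e (List.mem_cons_of_mem _ he)) (hS _ List.mem_cons_self _ _ hl hx)

end Walks

/-! ### Spanning trees of the wired graph as parent maps -/

section ParentMaps

variable {d : ℕ} {D : Finset (Fin d → ℤ)} {f g : (Fin d → ℤ) → (Fin d → ℤ)}

/-- `f` maps each point of `D` to one of its neighbours, and its iterates leave `D`. -/
structure IsParentMap (D : Finset (Fin d → ℤ)) (f : (Fin d → ℤ) → (Fin d → ℤ)) : Prop where
  nbr : ∀ v ∈ D, Nbr v (f v)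
  exits : ∀ v ∈ D, ∃ k, f^[k] v ∉ D

/-- The edges joining the points of `D` to their images under `f`. -/
def parentEdges {V : Type*} (D : Finset V) (f : V → V) : Set (Sym2 V) :=
  (fun v => s(v, f v)) '' (D : Set V)

/-- A height function which decreases along a map whose iterates leave `D`. -/
theorem exists_height {V : Type*} {D : Finset V} {f : V → V} (h : ∀ v ∈ D, ∃ k, f^[k] v ∉ D) :
    ∃ r : V → ℕ, (∀ v ∉ D, r v = 0) ∧ ∀ v ∈ D, r (f v) < r v := by
  classical
  have h' : ∀ v, ∃ k, f^[k] v ∉ D := fun v => by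
    by_cases hv : v ∈ D
    · exact h v hv
    · exact ⟨0, hv⟩
  refine ⟨fun v => Nat.find (h' v), fun v hv => (Nat.find_eq_zero _).2 hv, fun v hv => ?_⟩
  have h0 : Nat.find (h' v) ≠ 0 := fun h0 => (Nat.find_eq_zero (h' v)).1 h0 hv
  obtain ⟨k, hk⟩ := Nat.exists_eq_succ_of_ne_zero h0
  have hs := Nat.find_spec (h' v)
  rw [hk, Function.iterate_succ_apply] at hs
  change Nat.find (h' (f v)) < Nat.find (h' v)
  rw [hk]
  exact Nat.lt_succ_of_le (Nat.find_min' _ hs)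

theorem contract_of_mem {x : Fin d → ℤ} (h : x ∈ D) : contract D x = some ⟨x, h⟩ := dif_pos h

theorem contract_of_notMem {x : Fin d → ℤ} (h : x ∉ D) : contract D x = none := dif_neg h

theorem contract_eq_some {x : Fin d → ℤ} {u : D} (h : contract D x = some u) : x = u := by
  unfold contract at h
  split_ifs at h
  · cases h; rfl

theorem IsParentMap.isLink (hf : IsParentMap D f) {v : Fin d → ℤ} (hv : v ∈ D) :
    (wiredGraph D).IsLink s(v, f v) (contract D v) (contract D (f v)) :=
  ⟨v, f v, rfl, hf.nbr v hv, Or.inl hv, rfl, rfl⟩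

theorem parentEdges_subset (hf : IsParentMap D f) :
    parentEdges D f ⊆ (wiredGraph D).edgeSet := by
  rintro _ ⟨v, hv, rfl⟩
  exact (hf.isLink hv).edge_mem

theorem restrict_isLink_contract (hf : IsParentMap D f) {v : Fin d → ℤ} (hv : v ∈ D) :
    ((wiredGraph D).restrict (parentEdges D f)).IsLink s(v, f v)
      (contract D v) (contract D (f v)) := by
  rw [restrict_isLink_iff]
  exact ⟨⟨v, hv, rfl⟩, hf.isLink hv⟩

theorem parentEdges_isConnected (hf : IsParentMap D f) :
    IsConnected ((wiredGraph D).restrict (parentEdges D f)) := by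
  obtain ⟨r, -, hr⟩ := exists_height hf.exits
  have key : ∀ n v, r v = n → ∃ w, IsWalk ((wiredGraph D).restrict (parentEdges D f))
      (contract D v) w none := by
    intro n
    induction n using Nat.strong_induction_on with
    | _ n ih =>
      intro v hn
      by_cases hv : v ∈ D
      · obtain ⟨w, hw⟩ := ih _ (hn ▸ hr v hv) (f v) rfl
        exact ⟨_, .cons (restrict_isLink_contract hf hv) hw⟩
      · exact ⟨[], by rw [contract_of_notMem hv]; exact .nil (Set.mem_univ _)⟩
  have key' : ∀ a : Option D, ∃ w, IsWalk ((wiredGraph D).restrict (parentEdges D f)) a w none := by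
    rintro (_ | ⟨v, hv⟩)
    · exact ⟨[], .nil (Set.mem_univ _)⟩
    · rw [← contract_of_mem hv]
      exact key _ v rfl
  refine ⟨⟨none, Set.mem_univ _⟩, fun a _ b _ => ?_⟩
  obtain ⟨w, hw⟩ := key' a
  obtain ⟨w', hw'⟩ := (key' b).choose_spec.reverse
  exact ⟨_, hw.append hw'⟩

/-- The points of `D` that `f` eventually maps to `u` inside `D`. -/
inductive Descends {V : Type*} (D : Finset V) (f : V → V) (u : V) : V → Prop
  | refl (hu : u ∈ D) : Descends D f u u
  | step {v : V} (hv : v ∈ D) (h : Descends D f u (f v)) : Descends D f u v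

theorem Descends.mem {V : Type*} {D : Finset V} {f : V → V} {u v : V} (h : Descends D f u v) :
    v ∈ D := by
  cases h <;> assumption

theorem Descends.height_le {V : Type*} {D : Finset V} {f : V → V} {u v : V} {r : V → ℕ}
    (hr : ∀ v ∈ D, r (f v) < r v) (h : Descends D f u v) : r u ≤ r v := by
  induction h with
  | refl _ => exact le_rfl
  | step hv _ ih => exact ih.trans (hr _ hv).le

/-- If a closed trail starts with the edge from `u` to `f u`, let `S` be the set of descendants of
`u`. No other tree edge crosses the boundary of `S`, so the rest of the trail cannot join the two
ends of the first edge. -/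
theorem parentEdges_isAcyclic (hf : IsParentMap D f) :
    IsAcyclic ((wiredGraph D).restrict (parentEdges D f)) := by
  obtain ⟨r, -, hr⟩ := exists_height hf.exits
  rintro ⟨a, w, hw0, hn, hw⟩
  cases hw with
  | nil _ => exact hw0 rfl
  | @cons e _ b _ w hl hw =>
    obtain ⟨hl1, hl2⟩ := restrict_isLink_iff.1 hl
    obtain ⟨u, hu, rfl⟩ := hl1
    have hu : u ∈ D := hu
    let S : Set (Option D) := {a | ∃ v : D, a = some v ∧ Descends D f u v}
    have hS : ∀ v, contract D v ∈ S ↔ Descends D f u v := by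
      intro v
      constructor
      · rintro ⟨v', h1, h2⟩
        rwa [contract_eq_some h1]
      · intro h
        exact ⟨⟨v, h.mem⟩, contract_of_mem h.mem, h⟩
    have h1 : contract D u ∈ S := (hS u).2 (.refl hu)
    have h2 : contract D (f u) ∉ S := fun h =>
      absurd (((hS _).1 h).height_le hr) (not_le.2 (hr u hu))
    have hinv : ∀ v ∈ D, s(v, f v) ∈ w → (contract D v ∈ S ↔ contract D (f v) ∈ S) := by
      intro v hv hvw
      have hvu : v ≠ u := by
        rintro rfl
        exact (List.nodup_cons.1 hn).1 hvw
      rw [hS, hS]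
      constructor
      · intro h
        cases h with
        | refl _ => exact absurd rfl hvu
        | step _ h => exact h
      · exact fun h => .step hv h
    have hinv' : ∀ e ∈ w, ∀ a b, ((wiredGraph D).restrict (parentEdges D f)).IsLink e a b →
        (a ∈ S ↔ b ∈ S) := by
      intro e he a b hl
      obtain ⟨v, hv, rfl⟩ := (restrict_isLink_iff.1 hl).1
      rcases hl.eq_and_eq_or_eq_and_eq (restrict_isLink_contract hf hv) with
        ⟨rfl, rfl⟩ | ⟨rfl, rfl⟩
      · exact hinv v hv he
      · exact (hinv v hv he).symm
    have hab : b ∈ S ↔ a ∈ S :=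
      ⟨fun h => hw.mem_of_forall (fun e he a b hl => (hinv' e he a b hl).1) h,
        fun h => by
          by_contra hb
          exact hw.mem_of_forall (S := Sᶜ)
            (fun e he a b hl => mt (hinv' e he a b hl).2) hb h⟩
    rcases hl.eq_and_eq_or_eq_and_eq (restrict_isLink_contract hf hu) with
      ⟨rfl, rfl⟩ | ⟨rfl, rfl⟩
    · exact h2 (hab.2 h1)
    · exact h2 (hab.1 h1)

theorem parentEdges_mem_spanningTrees (hf : IsParentMap D f) :
    parentEdges D f ∈ spanningTrees (wiredGraph D) :=
  ⟨parentEdges_subset hf, parentEdges_isConnected hf, parentEdges_isAcyclic hf⟩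

/-- A connected set of edges of the wired graph contains the edges of a parent map. -/
theorem exists_isParentMap_of_isConnected {T : Set (Sym2 (Fin d → ℤ))}
    (hT : IsConnected ((wiredGraph D).restrict T)) :
    ∃ f, IsParentMap D f ∧ parentEdges D f ⊆ T := by
  classical
  have hex : ∀ a : Option D, ∃ n, ∃ w : List (Sym2 (Fin d → ℤ)), w.length = n ∧
      IsWalk ((wiredGraph D).restrict T) a w none := fun a => by
    obtain ⟨w, hw⟩ := hT.2 a (Set.mem_univ _) none (Set.mem_univ _)
    exact ⟨_, w, rfl, hw⟩
  -- `ℓ` is the graph distance to `x₀` in `T`; the parent of a point is a neighbour strictly closer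
  -- to `x₀`.
  let ℓ : Option D → ℕ := fun a => Nat.find (hex a)
  have hstep : ∀ v, ∃ v', v ∈ D → Nbr v v' ∧ s(v, v') ∈ T ∧
      ℓ (contract D v') < ℓ (contract D v) := by
    intro v
    by_cases hv : v ∈ D
    swap
    · exact ⟨v, fun h => absurd h hv⟩
    obtain ⟨w, hwl, hw⟩ := Nat.find_spec (hex (contract D v))
    generalize ha : contract D v = a at hw hwl
    rw [contract_of_mem hv] at ha
    cases hw with
    | nil _ => simp at ha
    | @cons e _ b _ w hl hw =>
      obtain ⟨hl1, x, y, rfl, hxy, -, hx, rfl⟩ := restrict_isLink_iff.1 hl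
      have hxv : x = v := contract_eq_some (hx.trans ha.symm)
      subst hxv
      refine ⟨y, fun _ => ⟨hxy, hl1, ?_⟩⟩
      have h1 : ℓ (contract D y) ≤ w.length := Nat.find_min' _ ⟨w, rfl, hw⟩
      have h2 : w.length + 1 = ℓ a := hwl
      omega
  choose f hf using hstep
  refine ⟨f, ⟨fun v hv => (hf v hv).1, fun v hv => ?_⟩, ?_⟩
  · by_contra! hall
    have hlt : ∀ k, ℓ (contract D (f^[k] v)) + k ≤ ℓ (contract D v) := by
      intro k
      induction k with
      | zero => simp
      | succ k ih =>
        have := (hf _ (hall k)).2.2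
        rw [Function.iterate_succ_apply']
        omega
    have := hlt (ℓ (contract D v) + 1)
    omega
  · rintro _ ⟨v, hv, rfl⟩
    exact (hf v hv).2.1

/-- Every spanning tree is the set of edges of a parent map. -/
theorem exists_isParentMap_of_mem_spanningTrees {T : Set (Sym2 (Fin d → ℤ))}
    (hT : T ∈ spanningTrees (wiredGraph D)) : ∃ f, IsParentMap D f ∧ parentEdges D f = T := by
  obtain ⟨hTE, hTc, hTa⟩ := hT
  obtain ⟨f, hf, hfT⟩ := exists_isParentMap_of_isConnected hTc
  refine ⟨f, hf, hfT.antisymm fun e he => ?_⟩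
  by_contra hef
  -- An edge of `T` that is not a parent edge closes a cycle with the trail of parent edges joining
  -- its ends.
  obtain ⟨a, b, hab⟩ := Graph.exists_isLink_of_mem_edgeSet (hTE he)
  obtain ⟨w, hw⟩ := (parentEdges_isConnected hf).2 b (Set.mem_univ _) a (Set.mem_univ _)
  obtain ⟨w, hn, hw⟩ := hw.exists_nodup
  have hew : e ∉ w := fun h => by
    obtain ⟨u, v, -, hl, -⟩ := hw.exists_suffix h
    exact hef (restrict_isLink_iff.1 hl).1
  refine hTa ⟨a, e :: w, by simp, List.nodup_cons.2 ⟨hew, hn⟩,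
    .cons (restrict_isLink_iff.2 ⟨he, hab⟩) ?_⟩
  refine IsWalk.mono (G := (wiredGraph D).restrict (parentEdges D f)) (fun _ h => h) ?_ hw
  intro e a b hl
  have hl := restrict_isLink_iff.1 hl
  exact restrict_isLink_iff.2 ⟨hfT hl.1, hl.2⟩

/-- A parent map is determined by its edges. -/
theorem IsParentMap.eqOn_of_parentEdges_eq (hg : IsParentMap D g)
    (h : parentEdges D f = parentEdges D g) : ∀ v ∈ D, f v = g v := by
  obtain ⟨r, -, hr⟩ := exists_height hg.exits
  have key : ∀ n v, r v = n → v ∈ D → f v = g v := by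
    intro n
    induction n using Nat.strong_induction_on with
    | _ n ih =>
      intro v hn hv
      have hmem : s(v, g v) ∈ parentEdges D f := h ▸ ⟨v, hv, rfl⟩
      obtain ⟨u, hu, huv⟩ := hmem
      rcases Sym2.eq_iff.1 huv with ⟨rfl, h2⟩ | ⟨rfl, h2⟩
      · exact h2
      -- Here the edge is that of `g v` under `f`, so `f (g v) = v`. By induction `g (g v) = v`,
      -- which contradicts the decrease of the height.
      · have h3 := ih _ (hn ▸ hr v hv) (g v) rfl hu
        have h4 := hr _ hu
        have h5 := hr v hv
        rw [← h3, h2] at h4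
        omega
  exact fun v hv => key _ v rfl hv

theorem finite_spanningTrees_wiredGraph (D : Finset (Fin d → ℤ)) :
    (spanningTrees (wiredGraph D)).Finite := by
  have : spanningTrees (wiredGraph D) ⊆ Set.powerset ((fun p : (Fin d → ℤ) × (Fin d → ℤ) =>
      s(p.1, p.1 + p.2)) '' ((D ×ˢ unitSteps d : Finset _) : Set _)) := by
    intro T hT
    obtain ⟨f, hf, rfl⟩ := exists_isParentMap_of_mem_spanningTrees hT
    rintro _ ⟨v, hv, rfl⟩
    refine ⟨(v, f v - v), ?_, by simp⟩
    exact Finset.mem_coe.2 (Finset.mem_product.2 ⟨hv, hf.nbr v hv⟩)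
  exact Set.Finite.subset (((Finset.finite_toSet _).image _).powerset) this

end ParentMaps

/-! ### Loop-erasures that follow a map -/

section Chains

variable {V : Type*} [DecidableEq V] {f g : V → V} {A B D O O' : Finset V} {b b' y : V}
  {z : ℕ → V} {m : ℕ}

/-- The iterates of `f` from `y` visit each of the points of `O` in `A` before they leave `A`
at `b`. -/
inductive FChain (f : V → V) (b : V) : Finset V → V → Finset V → Prop
  | nil {A : Finset V} (hb : b ∉ A) : FChain f b A b ∅
  | cons {A O : Finset V} {y : V} (hy : y ∈ A) (hb : b ∉ A) (h : FChain f b (A.erase y) (f y) O) :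
      FChain f b A y (insert y O)

theorem FChain.notMem (h : FChain f b A y O) : b ∉ A := by cases h <;> assumption

theorem FChain.subset (h : FChain f b A y O) : O ⊆ A := by
  induction h with
  | nil _ => simp
  | cons hy _ _ ih => exact Finset.insert_subset hy (ih.trans (Finset.erase_subset _ _))

theorem FChain.of_notMem (hy : y ∉ A) (h : FChain f b A y O) : b = y ∧ O = ∅ := by
  cases h with
  | nil _ => exact ⟨rfl, rfl⟩
  | cons hy' _ _ => exact absurd hy' hy

theorem FChain.start_mem (hy : y ∈ A) (h : FChain f b A y O) : y ∈ O := by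
  cases h with
  | nil hb => exact absurd hy hb
  | cons _ _ _ => exact Finset.mem_insert_self _ _

theorem FChain.unique (h : FChain f b A y O) (h' : FChain f b' A y O') : b = b' ∧ O = O' := by
  induction h generalizing O' with
  | nil hb =>
    obtain ⟨h1, h2⟩ := h'.of_notMem hb
    exact ⟨h1.symm, h2.symm⟩
  | cons hy _ _ ih =>
    cases h' with
    | nil hb => exact absurd hy hb
    | cons _ _ h =>
      obtain ⟨rfl, rfl⟩ := ih h
      exact ⟨rfl, rfl⟩

theorem FChain.congr (h : FChain f b A y O) (hfg : ∀ v ∈ O, f v = g v) : FChain g b A y O := by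
  induction h with
  | nil hb => exact .nil hb
  | cons hy hb _ ih =>
    refine .cons hy hb ?_
    rw [← hfg _ (Finset.mem_insert_self _ _)]
    exact ih fun v hv => hfg v (Finset.mem_insert_of_mem hv)

/-- A path whose last jumps follow `f` enters such a point `v` on its last jump from `u`, so its
last visit to `v` cannot be at time 0. -/
theorem FChain.exists_pred (h : FChain f b A y O) {v : V} (hv : v ∈ O) (hvy : v ≠ y) :
    ∃ u ∈ O, f u = v := by
  induction h with
  | nil _ => simp at hv
  | @cons A O y _ _ h ih =>
    have hv' := Finset.mem_of_mem_insert_of_ne hv hvy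
    by_cases hvf : v = f y
    · exact ⟨y, Finset.mem_insert_self _ _, hvf.symm⟩
    · obtain ⟨u, hu, huv⟩ := ih hv' hvf
      exact ⟨u, Finset.mem_insert_of_mem hu, huv⟩

theorem FChain.exists_iterate (h : FChain f b A y O) : ∀ v ∈ insert y O, ∃ k, f^[k] v = b := by
  induction h with
  | nil _ => exact fun v hv => ⟨0, by simpa using hv⟩
  | @cons A O y _ _ h ih =>
    intro v hv
    rw [Finset.insert_idem, Finset.mem_insert] at hv
    rcases hv with rfl | hv
    · obtain ⟨k, hk⟩ := ih (f v) (Finset.mem_insert_self _ _)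
      exact ⟨k + 1, hk⟩
    · exact ih v (Finset.mem_insert_of_mem hv)

/-- The chain of a map whose iterates leave `D ⊇ A`. -/
theorem exists_fChain (hf : ∀ v ∈ D, ∃ k, f^[k] v ∉ D) (hA : A ⊆ D) (y : V) :
    ∃ b O, FChain f b A y O := by
  obtain ⟨r, hr0, hr⟩ := exists_height hf
  -- The bound on `r b` is carried along to ensure that the chain built in `A.erase y` does not end
  -- at `y` itself.
  have key : ∀ n y A, r y = n → A ⊆ D → ∃ b O, FChain f b A y O ∧ r b ≤ r y := by
    intro n
    induction n using Nat.strong_induction_on with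
    | _ n ih =>
      intro y A hn hA
      by_cases hy : y ∈ A
      · have hlt := hr y (hA hy)
        obtain ⟨b, O, h, hb⟩ := ih _ (hn ▸ hlt) (f y) (A.erase y) rfl
          ((Finset.erase_subset _ _).trans hA)
        refine ⟨b, insert y O, .cons hy (fun hbA => ?_) h, by omega⟩
        refine h.notMem (Finset.mem_erase.2 ⟨?_, hbA⟩)
        rintro rfl
        omega
      · exact ⟨y, ∅, .nil hy, le_rfl⟩
  obtain ⟨b, O, h, -⟩ := key _ y A rfl hA
  exact ⟨b, O, h⟩

/-- The last jump of the path `z` from `v` up to the time `m` is to `f v`. -/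
def LastJump (f : V → V) (z : ℕ → V) (m : ℕ) (v : V) : Prop :=
  ∃ r < m, z r = v ∧ z (r + 1) = f v ∧ ∀ s ≤ m, r < s → z s ≠ v

/-- The path `z` leaves `A` at the point `b`, and jumps for the last time from each `v ∈ O` to
`f v`. -/
def ExitsAlong (f : V → V) (A O : Finset V) (b : V) (z : ℕ → V) : Prop :=
  ∃ m, z m = b ∧ (∀ s < m, z s ∈ A) ∧ ∀ v ∈ O, LastJump f z m v

omit [DecidableEq V] in
theorem ExitsAlong.congr (h : ExitsAlong f A O b z) (hfg : ∀ v ∈ O, f v = g v) :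
    ExitsAlong g A O b z := by
  obtain ⟨m, h1, h2, h3⟩ := h
  refine ⟨m, h1, h2, fun v hv => ?_⟩
  obtain ⟨r, hr, h4, h5, h6⟩ := h3 v hv
  exact ⟨r, hr, h4, h5.trans (hfg v hv), h6⟩

/-- First-step decomposition of the event `ExitsAlong`. -/
theorem exitsAlong_iff_shift (h : FChain f b (A.erase y) (f y) O) (hy : y ∈ A) (hb : b ∉ A)
    (hz : z 0 ∈ A) :
    ExitsAlong f A (insert y O) b z ↔
      ExitsAlong f A (insert y O) b (fun r => z (r + 1)) ∨
        z 0 = y ∧ z 1 = f y ∧ ExitsAlong f (A.erase y) O b (fun r => z (r + 1)) := by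
  have hyO : y ∉ O := fun hyO => absurd (h.subset hyO) (by simp)
  have hc : FChain f b A y (insert y O) := .cons hy hb h
  constructor
  · rintro ⟨m, h1, h2, h3⟩
    obtain ⟨m, rfl⟩ : ∃ k, m = k + 1 := Nat.exists_eq_succ_of_ne_zero fun h0 => by
      subst h0; exact hb (h1 ▸ hz)
    -- Only `y` can be left for the last time at time 0, so all other last jumps survive the shift.
    have hpos : ∀ v ∈ insert y O, v ≠ y → LastJump f (fun r => z (r + 1)) m v := by
      intro v hv hvy
      obtain ⟨r, hr, h4, h5, h6⟩ := h3 v hv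
      cases r with
      | succ r =>
        exact ⟨r, by omega, h4, h5, fun s hs hrs => h6 (s + 1) (by omega) (by omega)⟩
      | zero =>
        exfalso
        obtain ⟨u, hu, rfl⟩ := hc.exists_pred hv hvy
        obtain ⟨r, hr, -, h7, -⟩ := h3 u hu
        exact h6 (r + 1) (by omega) (by omega) h7
    obtain ⟨r, hr, h4, h5, h6⟩ := h3 y (Finset.mem_insert_self _ _)
    -- The two alternatives: the path returns to `y` later, or it leaves `y` for good at its first
    -- step and then lives in `A.erase y`.
    cases r with
    | succ r =>
      refine Or.inl ⟨m, h1, fun s hs => h2 (s + 1) (by omega), fun v hv => ?_⟩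
      by_cases hvy : v = y
      · subst hvy
        exact ⟨r, by omega, h4, h5, fun s hs hrs => h6 (s + 1) (by omega) (by omega)⟩
      · exact hpos v hv hvy
    | zero =>
      refine Or.inr ⟨h4, h5, m, h1, fun s hs => ?_, fun v hv => ?_⟩
      · exact Finset.mem_erase.2 ⟨h6 (s + 1) (by omega) (by omega), h2 (s + 1) (by omega)⟩
      · exact hpos v (Finset.mem_insert_of_mem hv) fun hvy => hyO (hvy ▸ hv)
  · have hup : ∀ {m v}, LastJump f (fun r => z (r + 1)) m v → LastJump f z (m + 1) v := by
      rintro m v ⟨r, hr, h4, h5, h6⟩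
      refine ⟨r + 1, by omega, h4, h5, fun s hs hrs => ?_⟩
      obtain ⟨s, rfl⟩ : ∃ k, s = k + 1 := Nat.exists_eq_succ_of_ne_zero (by omega)
      exact h6 s (by omega) (by omega)
    have hA : ∀ {m}, (∀ s < m, z (s + 1) ∈ A) → ∀ s < m + 1, z s ∈ A := by
      intro m h s hs
      cases s with
      | zero => exact hz
      | succ s => exact h s (by omega)
    rintro (⟨m, h1, h2, h3⟩ | ⟨h0, h01, m, h1, h2, h3⟩)
    · exact ⟨m + 1, h1, hA h2, fun v hv => hup (h3 v hv)⟩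
    · refine ⟨m + 1, h1, hA fun s hs => Finset.mem_of_mem_erase (h2 s hs), fun v hv => ?_⟩
      rcases Finset.mem_insert.1 hv with rfl | hv
      · refine ⟨0, by omega, h0, h01, fun s hs hrs => ?_⟩
        obtain ⟨s, rfl⟩ : ∃ k, s = k + 1 := Nat.exists_eq_succ_of_ne_zero (by omega)
        rcases Nat.lt_or_ge s m with hsm | hsm
        · exact Finset.ne_of_mem_erase (h2 s hsm)
        · obtain rfl : s = m := by omega
          rintro h7
          rw [← h1] at hb
          refine hb ?_
          change z (s + 1) ∈ A
          rwa [h7]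
      · exact hup (h3 v hv)

/-- The two cases of the first-step decomposition are exclusive. -/
theorem not_exitsAlong_insert (hb : b ∉ A) (h : ExitsAlong f (A.erase y) O b z) :
    ¬ ExitsAlong f A (insert y O) b z := by
  obtain ⟨m, h1, h2, -⟩ := h
  rintro ⟨m', h1', h2', h3'⟩
  have hm : m' ≤ m := by
    by_contra! hlt
    exact hb (h1 ▸ h2' m hlt)
  obtain ⟨r, hr, h4, -⟩ := h3' y (Finset.mem_insert_self _ _)
  exact Finset.ne_of_mem_erase (h2 r (by omega)) h4

omit [DecidableEq V] in
theorem not_exitsAlong_of_notMem (hO : O.Nonempty) (hz : z 0 ∉ A) : ¬ ExitsAlong f A O b z := by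
  rintro ⟨m, -, h2, h3⟩
  obtain ⟨v, hv⟩ := hO
  obtain ⟨r, hr, -⟩ := h3 v hv
  exact hz (h2 0 (by omega))

omit [DecidableEq V] in
theorem exitsAlong_empty (hz : z 0 = b) : ExitsAlong f A ∅ b z :=
  ⟨0, hz, fun s hs => absurd hs (Nat.not_lt_zero _), by simp⟩

/-! ### Last visits and the loop-erasure of a path leaving `A` -/

theorem lastVisit_le (v : V) : lastVisit z m v ≤ m := Nat.findGreatest_le _

theorem apply_lastVisit {s : ℕ} (hs : s ≤ m) : z (lastVisit z m (z s)) = z s :=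
  Nat.findGreatest_spec (P := fun r => z r = z s) hs rfl

theorem le_lastVisit {s : ℕ} (hs : s ≤ m) : s ≤ lastVisit z m (z s) :=
  Nat.le_findGreatest (P := fun r => z r = z s) hs rfl

theorem ne_of_lastVisit_lt {v : V} {s : ℕ} (h : lastVisit z m v < s) (hs : s ≤ m) : z s ≠ v :=
  Nat.findGreatest_is_greatest (P := fun r => z r = v) h hs

theorem LastJump.apply_lastVisit {v : V} (h : LastJump f z m v) :
    z (1 + lastVisit z m v) = f v := by
  obtain ⟨r, hr, h4, h5, h6⟩ := h
  have : lastVisit z m v = r := by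
    refine Nat.findGreatest_eq_iff.2 ⟨hr.le, fun _ => h4, fun s h7 h8 => h6 s h8 h7⟩
  rw [this, add_comm, h5]

/-- A path that leaves `A` does it along the map `v ↦ z (1 + lastVisit z m v)`. -/
theorem exists_exitsAlong (hm : z m ∉ A) (hA : ∀ s < m, z s ∈ A)
    (hf : ∀ v ∈ A, f v = z (1 + lastVisit z m v)) :
    ∃ O, FChain f (z m) A (z 0) O ∧ ExitsAlong f A O (z m) z := by
  -- Induction on the remaining time `m - t`: `A'` is `A` without the points already left for the
  -- last time, and the next `t` is one more than the last visit to `z t`.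
  have key : ∀ n t A', m - t = n → t ≤ m → A' ⊆ A → (∀ s, t ≤ s → s < m → z s ∈ A') →
      ∃ O, FChain f (z m) A' (z t) O ∧ ∀ v ∈ O, LastJump f z m v := by
    intro n
    induction n using Nat.strong_induction_on with
    | _ n ih =>
      intro t A' hn ht hA' hs
      rcases ht.eq_or_lt with rfl | ht
      · exact ⟨∅, .nil fun h => hm (hA' h), by simp⟩
      · have hle := le_lastVisit (z := z) ht.le
        have hat := apply_lastVisit (z := z) ht.le
        set r := lastVisit z m (z t) with hr
        have htA := hs t le_rfl ht
        have hrm : r < m := by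
          refine lt_of_le_of_ne (lastVisit_le _) fun h => ?_
          rw [h] at hat
          exact hm (hat ▸ hA' htA)
        have hft : f (z t) = z (1 + r) := hf _ (hA' htA)
        have hne : ∀ s ≤ m, r < s → z s ≠ z t := fun s hs hrs => ne_of_lastVisit_lt hrs hs
        obtain ⟨O, h1, h2⟩ := ih (m - (1 + r)) (by omega) (1 + r) (A'.erase (z t)) rfl (by omega)
          ((Finset.erase_subset _ _).trans hA')
          fun s hs1 hs2 => Finset.mem_erase.2 ⟨hne s hs2.le (by omega), hs s (by omega) hs2⟩
        refine ⟨insert (z t) O, .cons htA (fun h => hm (hA' h)) (hft ▸ h1), fun v hv => ?_⟩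
        rcases Finset.mem_insert.1 hv with rfl | hv
        · exact ⟨r, hrm, hat, by rw [hft, add_comm], hne⟩
        · exact h2 v hv
  obtain ⟨O, h1, h2⟩ := key _ 0 A rfl (Nat.zero_le _) subset_rfl fun s _ hs => hA s hs
  exact ⟨O, h1, m, rfl, hA, h2⟩

omit [DecidableEq V] in
theorem exitTime_eq {A : Set V} (hm : z m ∉ A) (hA : ∀ s < m, z s ∈ A) : exitTime A z = m := by
  refine le_antisymm (Nat.sInf_le hm) (le_csInf ⟨m, hm⟩ fun s hs => ?_)
  by_contra! h
  exact hs (hA s h)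

/-- The recursion for the loop-erasure reads the position that follows the last visit, which is the
image under `f` by `LastJump`. The starting index `j` is free for the sake of the induction along
the chain. -/
theorem loopErasure_of_fChain (h : FChain f b A y O) {j : ℕ} (hj : loopErasure z m j = y)
    (hO : ∀ v ∈ O, LastJump f z m v) :
    ∃ N, loopErasure z m (j + N) = b ∧
      (∀ v, v ∈ O ↔ ∃ i < N, loopErasure z m (j + i) = v) ∧
      ∀ i < N, loopErasure z m (j + i + 1) = f (loopErasure z m (j + i)) := by
  induction h generalizing j with
  | nil _ => exact ⟨0, hj, by simp, by simp⟩
  | @cons A O y _ _ h ih =>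
    have hj1 : loopErasure z m (j + 1) = f y := by
      rw [loopErasure, hj]
      exact (hO y (Finset.mem_insert_self _ _)).apply_lastVisit
    obtain ⟨N, h1, h2, h3⟩ := ih hj1 fun v hv => hO v (Finset.mem_insert_of_mem hv)
    refine ⟨N + 1, by rw [← h1]; congr 1; omega, fun v => ?_, fun i hi => ?_⟩
    · rw [Finset.mem_insert, h2]
      constructor
      · rintro (rfl | ⟨i, hi, h⟩)
        · exact ⟨0, by omega, hj⟩
        · exact ⟨i + 1, by omega, by rw [← h]; congr 1; omega⟩
      · rintro ⟨i, hi, h⟩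
        cases i with
        | zero => exact Or.inl (h.symm.trans hj)
        | succ i => exact Or.inr ⟨i, by omega, by rw [← h]; congr 1; omega⟩
    · cases i with
      | zero => exact hj1.trans (by rw [← hj]; rfl)
      | succ i =>
        have := h3 i (by omega)
        rw [show j + (i + 1) = j + 1 + i by omega]
        exact this

/-- The loop-erasure of a path that leaves `A` along `f`. -/
theorem loopErasurePath_of_exitsAlong (hc : FChain f b A (z 0) O) (hm : z m = b)
    (hO : ∀ v ∈ O, LastJump f z m v) :
    loopErasurePath z m = ⟨insert b O, (fun v => s(v, f v)) '' (O : Set V)⟩ := by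
  obtain ⟨N, h1, h2, h3⟩ := loopErasure_of_fChain hc (j := 0) rfl hO
  simp only [zero_add] at h1 h2 h3
  have hN : loopErasureLength z m = N := by
    refine le_antisymm (Nat.sInf_le (h1.trans hm.symm)) (le_csInf ⟨N, h1.trans hm.symm⟩ ?_)
    intro i hi
    by_contra! hlt
    have : loopErasure z m i ∈ O := (h2 _).2 ⟨i, hlt, rfl⟩
    rw [show loopErasure z m i = z m from hi, hm] at this
    exact hc.notMem (hc.subset this)
  unfold loopErasurePath
  rw [hN]
  congr 1
  · ext v
    simp only [Set.mem_ofPred_eq, Set.mem_insert_iff, Finset.mem_coe, h2]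
    constructor
    · rintro ⟨j, hj, rfl⟩
      rcases hj.eq_or_lt with rfl | hj
      · exact Or.inl h1
      · exact Or.inr ⟨j, hj, rfl⟩
    · rintro (rfl | ⟨j, hj, rfl⟩)
      · exact ⟨N, le_rfl, h1.symm⟩
      · exact ⟨j, hj.le, rfl⟩
  · ext e
    simp only [Set.mem_ofPred_eq, Set.mem_image, Finset.mem_coe, h2]
    constructor
    · rintro ⟨j, hj, rfl⟩
      exact ⟨_, ⟨j, hj, rfl⟩, by rw [h3 j hj]⟩
    · rintro ⟨_, ⟨j, hj, rfl⟩, rfl⟩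
      exact ⟨j, hj, by rw [h3 j hj]⟩

/-! ### The stages of Wilson's algorithm -/

/-- The stage `X` of the algorithm has visited the part `B` of `D`, with edges given by `f`. -/
structure Realizes (D : Finset V) (f : V → V) (X : Explored V) (B : Finset V) : Prop where
  mem_iff : ∀ v ∈ D, v ∈ X.verts ↔ v ∈ B
  edges_eq : X.edges = parentEdges B f

/-- If `y` is already explored, its chain is empty. Otherwise the end-point `b` of the loop-erasure
is outside `D` or already in `B`, so that only `O` is new in `D`. -/
theorem Realizes.wilsonStep {X : Explored V} (h : Realizes D f X B) (hy : y ∈ D) (hz : z 0 = y)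
    (hc : FChain f b (D \ B) y O) (hE : ExitsAlong f (D \ B) O b z) :
    Realizes D f (wilsonStep D y z X) (B ∪ O) := by
  unfold WilsonUST.wilsonStep
  by_cases hyX : y ∈ X.verts
  · have hyB : y ∉ D \ B := fun h' => (Finset.mem_sdiff.1 h').2 ((h.mem_iff y hy).1 hyX)
    obtain ⟨-, rfl⟩ := hc.of_notMem hyB
    rwa [if_pos hyX, Finset.union_empty]
  · obtain ⟨m, h1, h2, h3⟩ := hE
    have hDB : (D : Set V) \ X.verts = ((D \ B : Finset V) : Set V) := by
      ext v
      simp only [Set.mem_sdiff, Finset.mem_coe, Finset.mem_sdiff]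
      exact and_congr_right fun hv => not_congr (h.mem_iff v hv)
    have hexit : exitTime ((D : Set V) \ X.verts) z = m := by
      rw [hDB]
      exact exitTime_eq (h1 ▸ mt Finset.mem_coe.1 hc.notMem) fun s hs => Finset.mem_coe.2 (h2 s hs)
    rw [if_neg hyX, hexit, loopErasurePath_of_exitsAlong (hz ▸ hc) h1 h3]
    refine ⟨fun v hv => ?_, ?_⟩
    · simp only [Set.mem_union, Set.mem_insert_iff, Finset.mem_coe, Finset.mem_union,
        h.mem_iff v hv]
      refine or_congr_right' fun hvB => or_iff_right ?_
      rintro rfl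
      exact hc.notMem (Finset.mem_sdiff.2 ⟨hv, hvB⟩)
    · simp only [h.edges_eq, parentEdges, Finset.coe_union, Set.image_union]

/-- Starting from the part `B` of `D`, the walks `z` started from the points `y` of the list
explore successively the orbits of these points under `f`, ending with the part `B'`. -/
inductive Follows (f : V → V) (D : Finset V) :
    Finset V → List (V × (ℕ → V)) → Finset V → Prop
  | nil (B : Finset V) : Follows f D B [] B
  | cons {B O B' : Finset V} {b y : V} {z : ℕ → V} {l : List (V × (ℕ → V))}
      (hc : FChain f b (D \ B) y O) (hE : ExitsAlong f (D \ B) O b z)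
      (h : Follows f D (B ∪ O) l B') : Follows f D B ((y, z) :: l) B'

/-- The successive steps of Wilson's algorithm, from the stage `X`. -/
noncomputable def wilsonRun (D : Finset V) (l : List (V × (ℕ → V))) (X : Explored V) :
    Explored V :=
  l.foldl (fun X p => wilsonStep D p.1 p.2 X) X

/-- As a fold over a list, the algorithm lends itself to induction on the remaining walks from an
arbitrary stage. -/
theorem wilsonTree_eq_wilsonRun {n : ℕ} (D : Finset V) (x : Fin n → V) (z : Fin n → ℕ → V) :
    wilsonTree D x z = (wilsonRun D (List.ofFn fun k => (x k, z k)) ⟨∅, ∅⟩).edges := by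
  have key : ∀ k : Fin (n + 1), wilsonStages D x z k =
      wilsonRun D ((List.ofFn fun k => (x k, z k)).take k) ⟨∅, ∅⟩ := by
    intro k
    induction k using Fin.induction with
    | zero => rfl
    | succ k ih =>
      have h1 : wilsonStages D x z k.succ =
          wilsonStep D (x k) (z k) (wilsonStages D x z k.castSucc) := rfl
      have hk : (k : ℕ) < (List.ofFn fun k => (x k, z k)).length := by simp
      rw [h1, ih, Fin.val_succ, ← List.take_concat_get' _ _ hk]
      simp [wilsonRun]
  unfold wilsonTree
  rw [key, Fin.val_last, List.take_of_length_le (by simp)]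

variable {l : List (V × (ℕ → V))} {B' : Finset V}

theorem Follows.subset (h : Follows f D B l B') : B ⊆ B' := by
  induction h with
  | nil _ => exact subset_rfl
  | cons _ _ _ ih => exact Finset.subset_union_left.trans ih

theorem Follows.subset_of_subset (h : Follows f D B l B') (hB : B ⊆ D) : B' ⊆ D := by
  induction h with
  | nil _ => exact hB
  | cons hc _ _ ih =>
    exact ih (Finset.union_subset hB (hc.subset.trans Finset.sdiff_subset))

theorem Follows.mem (h : Follows f D B l B') {p : V × (ℕ → V)} (hp : p ∈ l) (hpD : p.1 ∈ D) :
    p.1 ∈ B' := by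
  induction h with
  | nil _ => simp at hp
  | @cons B O B' b y z l hc _ h ih =>
    rcases List.mem_cons.1 hp with rfl | hp
    · refine h.subset ?_
      by_cases hy : y ∈ B
      · exact Finset.mem_union_left _ hy
      · exact Finset.mem_union_right _ (hc.start_mem (Finset.mem_sdiff.2 ⟨hpD, hy⟩))
    · exact ih hp

theorem Follows.congr (h : Follows f D B l B') (hfg : ∀ v ∈ B', f v = g v) :
    Follows g D B l B' := by
  induction h with
  | nil _ => exact .nil _
  | cons hc hE h ih =>
    have hO := fun v hv => hfg v (h.subset (Finset.mem_union_right _ hv))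
    exact .cons (hc.congr hO) (hE.congr hO) (ih hfg)

/-- Each new orbit reaches its end-point `b`, which is either outside `D` or in the part explored
before, whose points already leave `D`. -/
theorem Follows.exits (h : Follows f D B l B') (hB : ∀ v ∈ B, ∃ k, f^[k] v ∉ D) :
    ∀ v ∈ B', ∃ k, f^[k] v ∉ D := by
  induction h with
  | nil _ => exact hB
  | @cons B O B' b y z l hc _ h ih =>
    refine ih fun v hv => ?_
    rcases Finset.mem_union.1 hv with hv | hv
    · exact hB v hv
    · obtain ⟨k, hk⟩ := hc.exists_iterate v (Finset.mem_insert_of_mem hv)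
      by_cases hbD : b ∈ D
      · have hbB : b ∈ B := by
          by_contra hbB
          exact hc.notMem (Finset.mem_sdiff.2 ⟨hbD, hbB⟩)
        obtain ⟨j, hj⟩ := hB b hbB
        exact ⟨j + k, by rwa [Function.iterate_add_apply, hk]⟩
      · exact ⟨k, hk ▸ hbD⟩

/-- On the new points, `v ↦ f v` is an actual jump of a walk. With `R` the neighbour relation, this
makes `f` a parent map. -/
theorem Follows.rel {R : V → V → Prop} (h : Follows f D B l B') (hB : ∀ v ∈ B, R v (f v))
    (hR : ∀ p ∈ l, ∀ r, R (p.2 r) (p.2 (r + 1))) : ∀ v ∈ B', R v (f v) := by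
  induction h with
  | nil _ => exact hB
  | @cons B O B' b y z l hc hE h ih =>
    refine ih (fun v hv => ?_) fun p hp => hR p (List.mem_cons_of_mem _ hp)
    rcases Finset.mem_union.1 hv with hv | hv
    · exact hB v hv
    · obtain ⟨m, -, -, h3⟩ := hE
      obtain ⟨r, -, h4, h5, -⟩ := h3 v hv
      rw [← h5, ← h4]
      exact hR (y, z) List.mem_cons_self r

theorem Follows.realizes (h : Follows f D B l B') {X : Explored V} (hX : Realizes D f X B)
    (hl : ∀ p ∈ l, p.1 ∈ D ∧ p.2 0 = p.1) : Realizes D f (wilsonRun D l X) B' := by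
  induction h generalizing X with
  | nil _ => exact hX
  | cons hc hE h ih =>
    obtain ⟨h1, h2⟩ := hl _ List.mem_cons_self
    exact ih (hX.wilsonStep h1 h2 hc hE) fun p hp => hl p (List.mem_cons_of_mem _ hp)

/-- Any family of walks that leave `D` follows some map. -/
theorem exists_follows (l : List (V × (ℕ → V)))
    (hl : ∀ p ∈ l, p.2 0 = p.1 ∧ ∃ r, p.2 r ∉ D) (B : Finset V) (f : V → V) :
    ∃ g B', (∀ v ∈ B, g v = f v) ∧ Follows g D B l B' := by
  induction l generalizing B f with
  | nil => exact ⟨f, B, fun _ _ => rfl, .nil _⟩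
  | cons p l ih =>
    obtain ⟨y, z⟩ := p
    obtain ⟨h0, h1⟩ : z 0 = y ∧ ∃ r, z r ∉ D := hl _ List.mem_cons_self
    have h2 : ∃ r, z r ∉ D \ B := h1.imp fun r hr h => hr (Finset.sdiff_subset h)
    have hm := Nat.find_spec h2
    have hA : ∀ s < Nat.find h2, z s ∈ D \ B := fun s hs => not_not.1 (Nat.find_min h2 hs)
    generalize Nat.find h2 = m at hm hA
    -- Keep the map on the explored part and use the last jumps of the current walk elsewhere. Only
    -- the values on `B ∪ O` are retained; later walks may change the others.
    let f1 : V → V := fun v => if v ∈ B then f v else z (1 + lastVisit z m v)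
    obtain ⟨O, hc, hE⟩ := exists_exitsAlong (f := f1) hm hA fun v hv =>
      if_neg (Finset.mem_sdiff.1 hv).2
    obtain ⟨g, B', hg, hF⟩ := ih (fun p hp => hl p (List.mem_cons_of_mem _ hp)) (B ∪ O) f1
    have hO : ∀ v ∈ O, f1 v = g v := fun v hv => (hg v (Finset.mem_union_right _ hv)).symm
    refine ⟨g, B', fun v hv => ?_, .cons (h0 ▸ hc.congr hO) (hE.congr hO) hF⟩
    exact (hg v (Finset.mem_union_left _ hv)).trans (if_pos hv)

end Chains

/-- When the walks leave `D`, Wilson's algorithm produces the edges of a parent map, which the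
walks follow. -/
theorem exists_isParentMap_follows {d : ℕ} {D : Finset (Fin d → ℤ)}
    {l : List ((Fin d → ℤ) × (ℕ → Fin d → ℤ))}
    (hl : ∀ p ∈ l, p.1 ∈ D ∧ p.2 0 = p.1 ∧ (∃ r, p.2 r ∉ D) ∧ ∀ r, Nbr (p.2 r) (p.2 (r + 1)))
    (hD : ∀ v ∈ D, ∃ p ∈ l, p.1 = v) :
    ∃ f, IsParentMap D f ∧ Follows f D ∅ l D := by
  obtain ⟨f, B, -, h⟩ := exists_follows l (fun p hp => ⟨(hl p hp).2.1, (hl p hp).2.2.1⟩) ∅ id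
  obtain rfl : B = D := (h.subset_of_subset (Finset.empty_subset _)).antisymm fun v hv => by
    obtain ⟨p, hp, rfl⟩ := hD v hv
    exact h.mem hp hv
  exact ⟨f, ⟨h.rel (by simp) fun p hp => (hl p hp).2.2.2, h.exits (by simp)⟩, h⟩

theorem Follows.wilsonRun_edges {V : Type*} [DecidableEq V] {f : V → V} {D : Finset V}
    {l : List (V × (ℕ → V))} (h : Follows f D ∅ l D) (hl : ∀ p ∈ l, p.1 ∈ D ∧ p.2 0 = p.1) :
    (wilsonRun D l ⟨∅, ∅⟩).edges = parentEdges D f :=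
  (h.realizes ⟨by simp, by simp [parentEdges]⟩ hl).edges_eq

/-- The outcome of Wilson's algorithm is the set of edges of a given parent map if and only if
the walks follow this map. -/
theorem wilsonRun_edges_eq_iff {d : ℕ} {D : Finset (Fin d → ℤ)}
    {l : List ((Fin d → ℤ) × (ℕ → Fin d → ℤ))}
    (hl : ∀ p ∈ l, p.1 ∈ D ∧ p.2 0 = p.1 ∧ (∃ r, p.2 r ∉ D) ∧ ∀ r, Nbr (p.2 r) (p.2 (r + 1)))
    (hD : ∀ v ∈ D, ∃ p ∈ l, p.1 = v) {f : (Fin d → ℤ) → (Fin d → ℤ)} (hf : IsParentMap D f) :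
    (wilsonRun D l ⟨∅, ∅⟩).edges = parentEdges D f ↔ Follows f D ∅ l D := by
  have hl' : ∀ p ∈ l, p.1 ∈ D ∧ p.2 0 = p.1 := fun p hp => ⟨(hl p hp).1, (hl p hp).2.1⟩
  refine ⟨fun h => ?_, fun h => h.wilsonRun_edges hl'⟩
  obtain ⟨g, hg, hF⟩ := exists_isParentMap_follows hl hD
  exact hF.congr (hf.eqOn_of_parentEdges_eq ((hF.wilsonRun_edges hl').symm.trans h))

/-! ### Linear algebra of the killed walk -/

section LinearAlgebra

variable {d : ℕ} {D A : Finset (Fin d → ℤ)} {e : (Fin d → ℤ) → ℝ}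

theorem single_mem_unitSteps (i : Fin d) : (Pi.single i 1 : Fin d → ℤ) ∈ unitSteps d :=
  Finset.mem_union_left _ (Finset.mem_image_of_mem _ (Finset.mem_univ i))

theorem card_unitSteps (d : ℕ) : (unitSteps d).card = 2 * d := by
  have hinj : ∀ c : ℤ, c ≠ 0 → Function.Injective fun i : Fin d => (Pi.single i c : Fin d → ℤ) := by
    intro c hc i j h
    by_contra hij
    have := congrFun h i
    simp [Pi.single_eq_of_ne hij, hc] at this
  rw [unitSteps, Finset.card_union_of_disjoint,
    Finset.card_image_of_injective _ (hinj _ one_ne_zero),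
    Finset.card_image_of_injective _ (hinj _ (by norm_num)), Finset.card_univ, Fintype.card_fin,
    two_mul]
  rw [Finset.disjoint_left]
  intro v h1 h2
  obtain ⟨i, -, rfl⟩ := Finset.mem_image.1 h1
  obtain ⟨j, -, h⟩ := Finset.mem_image.1 h2
  have := congrFun h i
  by_cases hij : i = j
  · subst hij; simp at this
  · simp [Pi.single_eq_of_ne hij] at this

theorem card_unitSteps_cast (d : ℕ) : ((unitSteps d).card : ℝ) = 2 * (d : ℝ) := by
  rw [card_unitSteps]; push_cast; ring

/-- The matrix `-Δ` on the rows indexed by `A`, and the identity on the other rows. -/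
noncomputable def killedMatrix (D A : Finset (Fin d → ℤ)) : Matrix D D ℝ :=
  Matrix.of fun x y => if (x : Fin d → ℤ) ∈ A then -dirichletLaplacian D x y
    else (Pi.single x 1 : D → ℝ) y

theorem killedMatrix_self (D : Finset (Fin d → ℤ)) :
    killedMatrix D D = -dirichletLaplacian D := by
  ext x y
  simp [killedMatrix]

theorem killedMatrix_empty (D : Finset (Fin d → ℤ)) : killedMatrix D ∅ = 1 := by
  ext x y
  simp [killedMatrix, Matrix.one_apply, Pi.single_apply, eq_comm]

/-- Keeping the size of the matrix fixed turns the removal of a point into a row replacement, which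
is the form of a diagonal entry of the adjugate in Cramer's rule. -/
theorem killedMatrix_erase (A : Finset (Fin d → ℤ)) (y : D) :
    killedMatrix D (A.erase y) = (killedMatrix D A).updateRow y (Pi.single y 1) := by
  ext x u
  by_cases hxy : x = y
  · subst hxy
    simp [killedMatrix]
  · have : (x : Fin d → ℤ) ≠ y := fun h => hxy (Subtype.ext h)
    simp [killedMatrix, hxy]

theorem sum_dirichletLaplacian_mul (he : ∀ u ∉ D, e u = 0) (x : D) :
    ∑ y : D, dirichletLaplacian D x y * e y = laplacian e x := by
  have h : ∀ u, ∑ y : D, (Pi.single (y : Fin d → ℤ) (1 : ℝ) : (Fin d → ℤ) → ℝ) u * e y = e u := by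
    intro u
    by_cases hu : u ∈ D
    · rw [Finset.sum_eq_single ⟨u, hu⟩]
      · simp
      · intro y _ hy
        rw [Pi.single_eq_of_ne, zero_mul]
        rintro rfl
        exact hy rfl
      · simp
    · rw [he u hu]
      refine Finset.sum_eq_zero fun y _ => ?_
      rw [Pi.single_eq_of_ne, zero_mul]
      rintro rfl
      exact hu y.2
  simp only [dirichletLaplacian, laplacian, Matrix.of_apply, sub_mul, Finset.sum_sub_distrib, h,
    mul_assoc, ← Finset.mul_sum, Finset.sum_mul]
  rw [Finset.sum_comm]
  simp only [h]

theorem killedMatrix_mulVec (hA : A ⊆ D) (he : ∀ u ∉ A, e u = 0) (x : D) :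
    (killedMatrix D A).mulVec (fun y => e y) x =
      if (x : Fin d → ℤ) ∈ A then -laplacian e x else 0 := by
  unfold Matrix.mulVec dotProduct killedMatrix
  split_ifs with hx
  · rw [← sum_dirichletLaplacian_mul fun u hu => he u fun h => hu (hA h)]
    simp [hx]
  · simp [hx, Pi.single_apply, he]

/-- A function which vanishes outside a finite set and is harmonic on it vanishes. -/
theorem eq_zero_of_laplacian_eq_zero [NeZero d] (he : ∀ u ∉ A, e u = 0)
    (hl : ∀ x ∈ A, laplacian e x = 0) (u : Fin d → ℤ) : e u = 0 := by
  by_contra hu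
  have huA : u ∈ A := by
    by_contra h
    exact hu (he u h)
  -- Among the points that maximise `|e|`, take one with the largest coordinate 0. Its neighbour in
  -- that direction has a strictly smaller `|e|`, which contradicts the mean value property.
  obtain ⟨x0, hx0, hmax⟩ := A.exists_max_image (fun x => |e x|) ⟨u, huA⟩
  obtain ⟨x, hx, hxmax⟩ := (A.filter fun x => |e x| = |e x0|).exists_max_image (fun x => x 0)
    ⟨x0, Finset.mem_filter.2 ⟨hx0, rfl⟩⟩
  obtain ⟨hxA, hxe⟩ := Finset.mem_filter.1 hx
  have hpos : 0 < |e x0| := (abs_pos.2 hu).trans_le (hmax u huA)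
  have hle : ∀ v, |e v| ≤ |e x0| := fun v => by
    by_cases hv : v ∈ A
    · exact hmax v hv
    · rw [he v hv, abs_zero]; exact hpos.le
  have hv0 := single_mem_unitSteps (0 : Fin d)
  have hlt : |e (x + Pi.single 0 1)| < |e x0| := by
    refine lt_of_le_of_ne (hle _) fun h => ?_
    have hmem : x + Pi.single 0 1 ∈ A := by
      by_contra hn
      rw [he _ hn, abs_zero] at h
      exact hpos.ne h
    have := hxmax _ (Finset.mem_filter.2 ⟨hmem, h⟩)
    simp at this
  have hd : (0 : ℝ) < 2 * d := by
    have := NeZero.pos d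
    positivity
  have hsum : ∑ v ∈ unitSteps d, |e (x + v)| < ∑ v ∈ unitSteps d, |e x0| :=
    Finset.sum_lt_sum (fun v _ => hle _) ⟨_, hv0, hlt⟩
  rw [Finset.sum_const, nsmul_eq_mul, card_unitSteps_cast, ← hxe] at hsum
  have hx1 := hl x hxA
  rw [laplacian, sub_eq_zero] at hx1
  have h1 : |e x| ≤ (2 * (d : ℝ))⁻¹ * ∑ v ∈ unitSteps d, |e (x + v)| := by
    rw [← hx1, abs_mul, abs_of_pos (inv_pos.2 hd)]
    exact mul_le_mul_of_nonneg_left (Finset.abs_sum_le_sum_abs _ _) (inv_pos.2 hd).le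
  rw [← div_eq_inv_mul, le_div_iff₀ hd] at h1
  linarith

/-- A kernel vector, extended by zero, vanishes off `A` thanks to the identity rows and is harmonic
on `A`, hence is zero by the maximum principle. -/
theorem det_killedMatrix_ne_zero [NeZero d] (hA : A ⊆ D) : (killedMatrix D A).det ≠ 0 := by
  intro h
  obtain ⟨v, hv0, hv⟩ := Matrix.exists_mulVec_eq_zero_iff.2 h
  let e : (Fin d → ℤ) → ℝ := fun u => if h : u ∈ D then v ⟨u, h⟩ else 0
  have hev : (fun y : D => e y) = v := funext fun y => dif_pos y.2
  have heA : ∀ u ∉ A, e u = 0 := by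
    intro u hu
    by_cases huD : u ∈ D
    · have h1 := congrFun hv ⟨u, huD⟩
      simp only [Matrix.mulVec, dotProduct, killedMatrix, Matrix.of_apply, hu, if_false,
        Pi.single_apply, ite_mul, one_mul, zero_mul, Finset.sum_ite_eq', Finset.mem_univ, if_true,
        Pi.zero_apply] at h1
      rw [← h1]
      exact dif_pos huD
    · exact dif_neg huD
  have hl : ∀ x ∈ A, laplacian e x = 0 := by
    intro x hx
    have h1 := killedMatrix_mulVec hA heA ⟨x, hA hx⟩
    rw [hev, hv, if_pos hx] at h1
    exact neg_eq_zero.1 h1.symm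
  refine hv0 (hev ▸ funext fun y => eq_zero_of_laplacian_eq_zero heA hl y)

/-- Cramer's rule for the value at its pole of a multiple of the Green function of `A`. -/
theorem mul_det_killedMatrix {q : ℝ} {y : Fin d → ℤ} (hA : A ⊆ D) (hy : y ∈ A)
    (he : ∀ u ∉ A, e u = 0) (hl : ∀ x ∈ A, -laplacian e x = if x = y then q else 0) :
    e y * (killedMatrix D A).det = q * (killedMatrix D (A.erase y)).det := by
  let y' : D := ⟨y, hA hy⟩
  have h1 : (killedMatrix D A).mulVec (fun y => e y) = q • Pi.single y' 1 := by
    funext x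
    rw [killedMatrix_mulVec hA he]
    by_cases hxy : x = y'
    · subst hxy
      simp [y', hy, hl]
    · have hxy' : (x : Fin d → ℤ) ≠ y := fun h => hxy (Subtype.ext h)
      simp only [Pi.smul_apply, Pi.single_eq_of_ne hxy, smul_zero]
      split_ifs with hx
      · rw [hl x hx, if_neg hxy']
      · rfl
  -- Multiply by the adjugate and read the entry at `y'`: its diagonal entry there is the
  -- determinant with row `y'` replaced by a basis vector.
  have h2 := congrArg (fun v => (killedMatrix D A).adjugate.mulVec v y') h1
  simp only [Matrix.mulVec_mulVec, Matrix.adjugate_mul, Matrix.smul_mulVec, Matrix.one_mulVec,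
    Matrix.mulVec_smul, Matrix.mulVec_single_one, Pi.smul_apply, smul_eq_mul, Matrix.col_apply,
    Matrix.adjugate_apply] at h2
  rw [← killedMatrix_erase] at h2
  rw [mul_comm, ← h2]

/-- The normalised determinant `(2d)^{|A|} det (-Δ_A)`. -/
noncomputable def treeWeight (D A : Finset (Fin d → ℤ)) : ℝ :=
  (2 * (d : ℝ)) ^ A.card * (killedMatrix D A).det

theorem treeWeight_ne_zero [NeZero d] (hA : A ⊆ D) : treeWeight D A ≠ 0 :=
  mul_ne_zero (pow_ne_zero _ (mul_ne_zero two_ne_zero (Nat.cast_ne_zero.2 (NeZero.ne d))))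
    (det_killedMatrix_ne_zero hA)

theorem treeWeight_empty (D : Finset (Fin d → ℤ)) : treeWeight D ∅ = 1 := by
  simp [treeWeight, killedMatrix_empty]

end LinearAlgebra

/-! ### The law of the simple random walk -/

section PathLaw

variable {d : ℕ}

/-- The path that is at `x` at time `0` and then follows `z`. -/
def prepend {V : Type*} (x : V) (z : ℕ → V) : ℕ → V
  | 0 => x
  | r + 1 => z r

theorem measurable_prepend {V : Type*} [MeasurableSpace V] :
    Measurable fun p : V × (ℕ → V) => prepend p.1 p.2 := by
  refine measurable_pi_lambda _ fun r => ?_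
  cases r with
  | zero => exact measurable_fst
  | succ r => exact (measurable_pi_apply r).comp measurable_snd

/-- The product of a measure `ν` and of the infinite product of copies of `ν` is an infinite
product. -/
theorem map_prepend_infinitePi {V : Type*} [MeasurableSpace V] (ν : Measure V)
    [IsProbabilityMeasure ν] :
    (ν.prod (Measure.infinitePi fun _ : ℕ => ν)).map (fun p => prepend p.1 p.2) =
      Measure.infinitePi fun _ : ℕ => ν := by
  classical
  refine Measure.eq_infinitePi _ fun s t ht => ?_
  rw [Measure.map_apply measurable_prepend (MeasurableSet.pi s.countable_toSet fun i _ => ht i)]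
  let s' : Finset ℕ := s.preimage Nat.succ Nat.succ_injective.injOn
  have hs' : (s.erase 0) = s'.image Nat.succ := by
    ext i
    cases i <;> simp [s']
  have hpre : (fun p : V × (ℕ → V) => prepend p.1 p.2) ⁻¹' (Set.pi s t) =
      (if 0 ∈ s then t 0 else Set.univ) ×ˢ Set.pi s' (fun i => t (i + 1)) := by
    ext ⟨v, z⟩
    simp only [Set.mem_preimage, Set.mem_pi, Finset.mem_coe, Set.mem_prod, s', Finset.mem_preimage]
    constructor
    · intro h
      refine ⟨?_, fun i hi => h (i + 1) hi⟩
      split_ifs with h0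
      · exact h 0 h0
      · trivial
    · rintro ⟨h0, h1⟩ i hi
      cases i with
      | zero => rwa [if_pos hi] at h0
      | succ i => exact h1 i hi
  rw [hpre, Measure.prod_prod, Measure.infinitePi_pi _ fun i _ => ht (i + 1),
    ← Finset.prod_image (f := fun i => ν (t i)) (g := Nat.succ) Nat.succ_injective.injOn, ← hs']
  split_ifs with h0
  · rw [Finset.mul_prod_erase s (fun i => ν (t i)) h0]
  · rw [measure_univ, one_mul, Finset.erase_eq_of_notMem h0]

/-- The law of the steps of the walk. -/
noncomputable def stepLaw (d : ℕ) : Measure (Fin d → ℤ) :=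
  uniformOn (unitSteps d : Set (Fin d → ℤ))

instance [NeZero d] : IsProbabilityMeasure (stepLaw d) :=
  isProbabilityMeasure_uniformOn (Finset.finite_toSet _) ⟨_, single_mem_unitSteps 0⟩

theorem lintegral_stepLaw (F : (Fin d → ℤ) → ENNReal) :
    ∫⁻ v, F v ∂stepLaw d = (2 * (d : ENNReal))⁻¹ * ∑ v ∈ unitSteps d, F v := by
  rw [stepLaw, uniformOn, ProbabilityTheory.cond, lintegral_smul_measure, lintegral_finset,
    Measure.count_apply_finset, card_unitSteps]
  simp

theorem ae_stepLaw : ∀ᵐ v ∂stepLaw d, v ∈ unitSteps d := by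
  rw [stepLaw, uniformOn]
  exact ae_cond_mem (Finset.measurableSet _)

/-- The path started at `x` with steps `ω`. -/
def walkPath (x : Fin d → ℤ) (ω : ℕ → Fin d → ℤ) (r : ℕ) : Fin d → ℤ :=
  x + ∑ i ∈ Finset.range r, ω i

theorem measurable_walkPath (x : Fin d → ℤ) : Measurable (walkPath x) := by
  unfold walkPath
  fun_prop

theorem walkPath_prepend (x v : Fin d → ℤ) (ω : ℕ → Fin d → ℤ) :
    walkPath x (prepend v ω) = prepend x (walkPath (x + v) ω) := by
  funext r
  cases r with
  | zero => simp [walkPath, prepend]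
  | succ r =>
    simp only [walkPath, prepend, Finset.sum_range_succ']
    abel

/-- The law of the simple random walk started at `x`. -/
noncomputable def pathLaw (x : Fin d → ℤ) : Measure (ℕ → Fin d → ℤ) :=
  (Measure.infinitePi fun _ : ℕ => stepLaw d).map (walkPath x)

instance [NeZero d] (x : Fin d → ℤ) : IsProbabilityMeasure (pathLaw x) :=
  Measure.isProbabilityMeasure_map (measurable_walkPath x).aemeasurable

theorem measurable_prepend_left (x : Fin d → ℤ) :
    Measurable (prepend x : (ℕ → Fin d → ℤ) → ℕ → Fin d → ℤ) :=
  measurable_prepend.comp measurable_prodMk_left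

theorem ae_pathLaw_zero (x : Fin d → ℤ) : ∀ᵐ z ∂pathLaw x, z 0 = x := by
  rw [pathLaw, ae_map_iff (measurable_walkPath x).aemeasurable
    (measurableSet_eq_fun (measurable_pi_apply 0) measurable_const)]
  exact Filter.Eventually.of_forall fun ω => by simp [walkPath]

/-- The simple Markov property at time `1`. -/
theorem pathLaw_real_eq_sum [NeZero d] (x : Fin d → ℤ) {S : Set (ℕ → Fin d → ℤ)}
    (hS : MeasurableSet S) :
    (pathLaw x).real S =
      (2 * (d : ℝ))⁻¹ * ∑ v ∈ unitSteps d, (pathLaw (x + v)).real (prepend x ⁻¹' S) := by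
  have h : pathLaw x S =
      (2 * (d : ENNReal))⁻¹ * ∑ v ∈ unitSteps d, pathLaw (x + v) (prepend x ⁻¹' S) := by
    have hpre : MeasurableSet ((fun p : (Fin d → ℤ) × (ℕ → Fin d → ℤ) => prepend p.1 p.2) ⁻¹'
        (walkPath x ⁻¹' S)) := measurable_prepend (measurable_walkPath x hS)
    rw [pathLaw, Measure.map_apply (measurable_walkPath x) hS, ← map_prepend_infinitePi,
      Measure.map_apply measurable_prepend (measurable_walkPath x hS), Measure.prod_apply hpre,
      lintegral_stepLaw]
    congr 1
    refine Finset.sum_congr rfl fun v _ => ?_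
    rw [pathLaw, Measure.map_apply (measurable_walkPath _) (measurable_prepend_left x hS)]
    congr 1
    ext ω
    simp only [Set.mem_preimage, walkPath_prepend]
  simp only [Measure.real, h, ENNReal.toReal_mul, ENNReal.toReal_inv]
  rw [ENNReal.toReal_sum fun v _ => measure_ne_top _ _]
  simp

/-- A simple random walk has the law `pathLaw`. -/
theorem IsSimpleRandomWalk.hasLaw {Ω : Type*} [MeasurableSpace Ω] {P : Measure Ω}
    {x : Fin d → ℤ} {Z : ℕ → Ω → (Fin d → ℤ)} (h : IsSimpleRandomWalk P x Z) :
    HasLaw (fun ω r => Z r ω) (pathLaw x) P := by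
  have hZ := h.measurable
  have h1 : HasLaw (fun ω r => Z (r + 1) ω - Z r ω) (Measure.infinitePi fun _ : ℕ => stepLaw d) P :=
    h.indep.hasLaw_infinitePi h.step (Measurable.aemeasurable (by fun_prop))
  refine ⟨Measurable.aemeasurable (by fun_prop), ?_⟩
  rw [pathLaw, ← h1.map_eq, AEMeasurable.map_map_of_aemeasurable
    (measurable_walkPath x).aemeasurable h1.aemeasurable]
  refine Measure.map_congr ?_
  filter_upwards [h.start] with ω hω
  funext r
  simp [walkPath, Finset.sum_range_sub (fun r => Z r ω), hω]

theorem IsSimpleRandomWalk.ae_nbr {Ω : Type*} [MeasurableSpace Ω] {P : Measure Ω}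
    {x : Fin d → ℤ} {Z : ℕ → Ω → (Fin d → ℤ)} (h : IsSimpleRandomWalk P x Z) :
    ∀ᵐ ω ∂P, ∀ r, Nbr (Z r ω) (Z (r + 1) ω) := by
  refine ae_all_iff.2 fun r => ?_
  refine ae_of_ae_map (h.step r).aemeasurable (p := (· ∈ unitSteps d)) ?_
  rw [(h.step r).map_eq]
  exact ae_stepLaw

end PathLaw

/-! ### Exit probabilities -/

section Exit

variable {d : ℕ} {D A O : Finset (Fin d → ℤ)} {f : (Fin d → ℤ) → (Fin d → ℤ)}
  {b y : Fin d → ℤ}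

theorem measurableSet_exitsAlong (f : (Fin d → ℤ) → (Fin d → ℤ)) (A O : Finset (Fin d → ℤ))
    (b : Fin d → ℤ) : MeasurableSet {z : ℕ → Fin d → ℤ | ExitsAlong f A O b z} := by
  have hs : ∀ (r : ℕ) (S : Set (Fin d → ℤ)), MeasurableSet {z : ℕ → Fin d → ℤ | z r ∈ S} :=
    fun r S => measurable_pi_apply r (Set.to_countable S).measurableSet
  unfold ExitsAlong LastJump
  refine measurableSet_setOfPred.2 (Measurable.exists fun m => ?_)
  refine (measurableSet_setOfPred.1 (hs m {b})).and (Measurable.and ?_ ?_)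
  · exact Measurable.forall fun s => Measurable.forall fun _ => measurableSet_setOfPred.1 (hs s A)
  · refine Measurable.forall fun v => Measurable.forall fun _ => Measurable.exists fun r => ?_
    refine measurable_const.and ((measurableSet_setOfPred.1 (hs r {v})).and
      ((measurableSet_setOfPred.1 (hs (r + 1) {f v})).and ?_))
    exact Measurable.forall fun s => Measurable.forall fun _ => Measurable.forall fun _ =>
      (measurableSet_setOfPred.1 (hs s {v})).not

/-- The simple random walk leaves every finite set. -/
theorem ae_pathLaw_exits [NeZero d] (D : Finset (Fin d → ℤ)) (x : Fin d → ℤ) :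
    ∀ᵐ z ∂pathLaw x, ∃ r, z r ∉ D := by
  let S : Set (ℕ → Fin d → ℤ) := {z | ∀ r, z r ∈ D}
  have hS : MeasurableSet S := by
    have : S = ⋂ r, (fun z : ℕ → Fin d → ℤ => z r) ⁻¹' (D : Set (Fin d → ℤ)) := by
      ext z; simp [S]
    rw [this]
    exact MeasurableSet.iInter fun r => measurable_pi_apply r (Finset.measurableSet _)
  -- The probability of staying in `D` forever, as a function of the starting point, vanishes off
  -- `D` and is harmonic on `D`.
  have h0 : (pathLaw x).real S = 0 := by
    refine eq_zero_of_laplacian_eq_zero (A := D) (e := fun u => (pathLaw u).real S) ?_ ?_ x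
    · intro u hu
      refine (measureReal_eq_zero_iff).2 ?_
      refine measure_eq_zero_iff_ae_notMem.2 ?_
      filter_upwards [ae_pathLaw_zero u] with z hz h
      exact hu (hz ▸ h 0)
    · intro u hu
      rw [laplacian, sub_eq_zero, pathLaw_real_eq_sum u hS]
      congr 1
      refine Finset.sum_congr rfl fun v _ => ?_
      congr 1
      ext z
      constructor
      · intro h r
        cases r with
        | zero => exact hu
        | succ r => exact h r
      · exact fun h r => h (r + 1)
  have h1 := measure_eq_zero_iff_ae_notMem.1 ((measureReal_eq_zero_iff).1 h0)
  filter_upwards [h1] with z hz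
  by_contra! h
  exact hz h

/-- The probability that the loop-erasure of the walk follows a given chain. -/
theorem pathLaw_real_exitsAlong [NeZero d] (hf : IsParentMap D f) (h : FChain f b A y O)
    (hA : A ⊆ D) :
    (pathLaw y).real {z | ExitsAlong f A O b z} = treeWeight D (A \ O) / treeWeight D A := by
  induction h with
  | @nil A hb =>
    rw [Finset.sdiff_empty, div_self (treeWeight_ne_zero hA)]
    rw [← probReal_univ (μ := pathLaw b)]
    refine measureReal_congr ?_
    filter_upwards [ae_pathLaw_zero b] with z hz
    exact eq_true (exitsAlong_empty hz)
  | @cons A O y hy hb h ih =>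
    have ih := ih ((Finset.erase_subset _ _).trans hA)
    set p := (pathLaw (f y)).real {z | ExitsAlong f (A.erase y) O b z} with hp
    let e : (Fin d → ℤ) → ℝ := fun u => (pathLaw u).real {z | ExitsAlong f A (insert y O) b z}
    have hd : (d : ℝ) ≠ 0 := Nat.cast_ne_zero.2 (NeZero.ne d)
    have he : ∀ u ∉ A, e u = 0 := by
      intro u hu
      refine (measureReal_eq_zero_iff).2 (measure_eq_zero_iff_ae_notMem.2 ?_)
      filter_upwards [ae_pathLaw_zero u] with z hz
      exact not_exitsAlong_of_notMem (Finset.insert_nonempty _ _) (hz ▸ hu)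
    -- After one step from `u`, either the same event remains to be realised, or that step is the
    -- final jump from `y` to `f y` and only the rest of the chain remains, with probability `p`.
    have hstep : ∀ u ∈ A, ∀ v, (pathLaw (u + v)).real
        (prepend u ⁻¹' {z | ExitsAlong f A (insert y O) b z}) =
          e (u + v) + if u = y ∧ u + v = f y then p else 0 := by
      intro u hu v
      split_ifs with huv
      · obtain ⟨rfl, huv⟩ := huv
        rw [huv, hp, ← measureReal_union]
        · refine measureReal_congr ?_
          filter_upwards [ae_pathLaw_zero (f u)] with z hz
          refine propext ((exitsAlong_iff_shift (z := prepend u z) h hu hb hu).trans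
            (or_congr_right ?_))
          exact ⟨fun h => h.2.2, fun h => ⟨rfl, hz, h⟩⟩
        · rw [Set.disjoint_left]
          exact fun z h1 h2 => not_exitsAlong_insert hb h2 h1
        · exact measurableSet_exitsAlong _ _ _ _
      · rw [add_zero]
        refine measureReal_congr ?_
        filter_upwards [ae_pathLaw_zero (u + v)] with z hz
        refine propext ((exitsAlong_iff_shift (z := prepend u z) h hy hb hu).trans
          (or_iff_left ?_))
        rintro ⟨h1, h2, -⟩
        exact huv ⟨h1, hz.symm.trans h2⟩
    have hl : ∀ x ∈ A, -laplacian e x = if x = y then (2 * (d : ℝ))⁻¹ * p else 0 := by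
      intro x hx
      have h1 : e x = _ := pathLaw_real_eq_sum x (measurableSet_exitsAlong f A (insert y O) b)
      simp only [hstep x hx, Finset.sum_add_distrib, mul_add] at h1
      rw [laplacian, neg_sub, h1, add_sub_cancel_left]
      split_ifs with hxy
      · subst hxy
        rw [Finset.sum_eq_single (f x - x)]
        · simp
        · intro v _ hv
          rw [if_neg]
          rintro ⟨-, h2⟩
          exact hv (by rw [← h2, add_sub_cancel_left])
        · intro h2
          exact absurd (hf.nbr x (hA hx)) h2
      · simp [hxy]
    have hC := mul_det_killedMatrix hA hy he hl
    have hsd : A \ insert y O = A.erase y \ O := by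
      ext v
      simp only [Finset.mem_sdiff, Finset.mem_insert, Finset.mem_erase, not_or]
      tauto
    rw [hsd]
    rw [eq_div_iff (treeWeight_ne_zero ((Finset.erase_subset _ _).trans hA))] at ih
    rw [eq_div_iff (treeWeight_ne_zero hA), ← ih]
    change e y * _ = _
    unfold treeWeight
    -- The extra factor `2 * d` in the weight of `A` cancels the probability `(2 * d)⁻¹` of the jump
    -- from `y` to `f y`.
    rw [← Finset.card_erase_add_one hy, pow_succ]
    calc e y * ((2 * (d : ℝ)) ^ (A.erase y).card * (2 * d) * (killedMatrix D A).det)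
        = (2 * (d : ℝ)) ^ (A.erase y).card * (2 * d) * (e y * (killedMatrix D A).det) := by ring
      _ = _ := by rw [hC]; field_simp

end Exit

/-! ### The law of the tree -/

/-- A random variable that takes each value of a finite set with the same probability, and almost
surely no other value, is uniformly distributed on this set. -/
theorem hasLaw_uniformOn {Ω E : Type*} [MeasurableSpace Ω] [MeasurableSpace E]
    [MeasurableSingletonClass E] {P : Measure Ω} [IsProbabilityMeasure P] {X : Ω → E} {S : Set E}
    (hS : S.Finite) (hX : ∀ᵐ ω ∂P, X ω ∈ S) {c : ENNReal}
    (hm : ∀ T ∈ S, NullMeasurableSet (X ⁻¹' {T}) P) (hc : ∀ T ∈ S, P (X ⁻¹' {T}) = c) :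
    (S.ncard : ENNReal) * c = 1 ∧ HasLaw X (uniformOn S) P := by
  classical
  lift S to Finset E using hS
  -- Up to a null event every preimage is a finite union of fibres over `S`, so null-measurability
  -- of these fibres suffices.
  have hpre : ∀ s : Set E, (X ⁻¹' s : Set Ω) =ᵐ[P] ⋃ T ∈ S.filter (· ∈ s), X ⁻¹' {T} := by
    intro s
    filter_upwards [hX] with ω hω
    refine propext ?_
    change X ω ∈ s ↔ ω ∈ ⋃ T ∈ S.filter (· ∈ s), X ⁻¹' {T}
    simp only [Set.mem_iUnion, Finset.mem_filter, Set.mem_preimage, Set.mem_singleton_iff,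
      exists_prop]
    exact ⟨fun h => ⟨X ω, ⟨hω, h⟩, rfl⟩, by rintro ⟨T, ⟨-, hT⟩, rfl⟩; exact hT⟩
  have hnull : ∀ s : Set E, NullMeasurableSet (X ⁻¹' s) P := fun s =>
    (NullMeasurableSet.biUnion (Finset.countable_toSet _)
      fun T hT => hm T (Finset.mem_filter.1 hT).1).congr (hpre s).symm
  have hmeas : ∀ s : Set E, P (X ⁻¹' s) = (S.filter (· ∈ s)).card * c := by
    intro s
    rw [measure_congr (hpre s), measure_biUnion_finset₀, Finset.sum_congr rfl
      fun T hT => hc T (Finset.mem_filter.1 hT).1, Finset.sum_const, nsmul_eq_mul]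
    · intro T _ T' _ hTT'
      refine Disjoint.aedisjoint (Set.disjoint_left.2 ?_)
      rintro ω rfl rfl
      exact hTT' rfl
    · exact fun T hT => hm T (Finset.mem_filter.1 hT).1
  have hone : (S.card : ENNReal) * c = 1 := by
    have h1 : P (X ⁻¹' S) = S.card * c := by simpa using hmeas S
    rw [← h1, ← measure_univ (μ := P)]
    exact measure_congr (hX.mono fun ω hω => eq_true hω)
  have hcS : c = (S.card : ENNReal)⁻¹ := ENNReal.eq_inv_of_mul_eq_one_left (by rwa [mul_comm])
  have hae : AEMeasurable X P := by
    have : Finite (S : Set E) := S.finite_toSet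
    exact NullMeasurable.aemeasurable_of_aerange (t := (S : Set E)) (fun s _ => hnull s) hX
  refine ⟨by rwa [Set.ncard_coe_finset], hae, ?_⟩
  refine Measure.ext fun s hs => ?_
  have hsS : (S : Set E) ∩ s = (S.filter (· ∈ s) : Finset E) := by
    ext T; simp
  rw [Measure.map_apply_of_aemeasurable hae hs, hmeas, ← uniformOn_inter_self S.finite_toSet, hsS,
    uniformOn_apply_finset, Finset.inter_eq_right.2 (Finset.filter_subset _ _), hcS,
    div_eq_mul_inv]

section Law

variable {d : ℕ} {D : Finset (Fin d → ℤ)} {f : (Fin d → ℤ) → (Fin d → ℤ)}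

/-- The event that the walks follow a given parent map is a box, with a probability that does not
depend on this map. -/
theorem exists_follows_iff_forall_mem [NeZero d] (hf : IsParentMap D f) {n : ℕ}
    (x : Fin n → Fin d → ℤ) (hx : ∀ k, x k ∈ D) {B : Finset (Fin d → ℤ)} (hB : B ⊆ D)
    (hcov : ∀ v ∈ D, v ∈ B ∨ ∃ k, x k = v) :
    ∃ S : Fin n → Set (ℕ → Fin d → ℤ), (∀ k, MeasurableSet (S k)) ∧
      (∀ z : Fin n → ℕ → Fin d → ℤ,
        Follows f D B (List.ofFn fun k => (x k, z k)) D ↔ ∀ k, z k ∈ S k) ∧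
      ∏ k, (pathLaw (x k)).real (S k) = (treeWeight D (D \ B))⁻¹ := by
  induction n generalizing B with
  | zero =>
    obtain rfl : B = D := hB.antisymm fun v hv => (hcov v hv).resolve_right fun ⟨k, _⟩ => k.elim0
    refine ⟨fun k => k.elim0, fun k => k.elim0, fun z => ?_, ?_⟩
    · simpa using Follows.nil B
    · simp [treeWeight_empty]
  | succ n ih =>
    -- The chain depends on `f`, `B` and `x 0` but not on the walk; this makes the event a box.
    obtain ⟨b, O, hc⟩ := exists_fChain hf.exits (Finset.sdiff_subset (s := D) (t := B)) (x 0)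
    have hO : O ⊆ D := hc.subset.trans Finset.sdiff_subset
    obtain ⟨S, hS1, hS2, hS3⟩ := ih (fun k => x k.succ) (fun k => hx _)
      (B := B ∪ O) (Finset.union_subset hB hO) (by
        intro v hv
        rcases hcov v hv with h | ⟨k, rfl⟩
        · exact Or.inl (Finset.mem_union_left _ h)
        · cases k using Fin.cases with
          | zero =>
            refine Or.inl ?_
            by_cases h : x 0 ∈ B
            · exact Finset.mem_union_left _ h
            · exact Finset.mem_union_right _ (hc.start_mem (Finset.mem_sdiff.2 ⟨hv, h⟩))
          | succ k => exact Or.inr ⟨k, rfl⟩)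
    refine ⟨Fin.cons {z | ExitsAlong f (D \ B) O b z} S, fun k => ?_, fun z => ?_, ?_⟩
    · cases k using Fin.cases with
      | zero => exact measurableSet_exitsAlong _ _ _ _
      | succ k => exact hS1 k
    · rw [List.ofFn_succ, Fin.forall_fin_succ]
      simp only [Fin.cons_zero, Fin.cons_succ]
      rw [← hS2 fun k => z k.succ]
      constructor
      · intro h
        cases h with
        | cons hc' hE h =>
          obtain ⟨rfl, rfl⟩ := hc.unique hc'
          exact ⟨hE, h⟩
      · exact fun h => .cons hc h.1 h.2
    · rw [Fin.prod_univ_succ]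
      simp only [Fin.cons_zero, Fin.cons_succ]
      -- The numerator of the new factor cancels the inverse weight given by the remaining walks.
      rw [hS3, pathLaw_real_exitsAlong hf hc Finset.sdiff_subset, sdiff_sdiff_left,
        Finset.sup_eq_union, div_eq_mul_inv, mul_right_comm, mul_inv_cancel₀, one_mul]
      exact treeWeight_ne_zero Finset.sdiff_subset

variable {Ω : Type*} [MeasurableSpace Ω] {P : Measure Ω} [IsProbabilityMeasure P]
  {n : ℕ} {x : Fin n ≃ D} {Z : Fin n → ℕ → Ω → (Fin d → ℤ)}

omit [IsProbabilityMeasure P] in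
theorem ae_forall_exists_notMem [NeZero d]
    (hZ : ∀ k, IsSimpleRandomWalk P (x k : Fin d → ℤ) (Z k)) :
    ∀ᵐ ω ∂P, ∀ k, ∃ r, Z k r ω ∉ D := by
  refine ae_all_iff.2 fun k => ?_
  refine ae_of_ae_map (hZ k).hasLaw.aemeasurable (p := fun z => ∃ r, z r ∉ D) ?_
  rw [(hZ k).hasLaw.map_eq]
  exact ae_pathLaw_exits D _

omit [IsProbabilityMeasure P] in
theorem measure_follows [NeZero d] (hf : IsParentMap D f)
    (hZ : ∀ k, IsSimpleRandomWalk P (x k : Fin d → ℤ) (Z k))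
    (hI : iIndepFun (fun k ω r => Z k r ω) P) :
    MeasurableSet {ω | Follows f D ∅ (List.ofFn fun k => ((x k : Fin d → ℤ), fun r => Z k r ω)) D} ∧
    P.real {ω | Follows f D ∅ (List.ofFn fun k => ((x k : Fin d → ℤ), fun r => Z k r ω)) D} =
      (treeWeight D D)⁻¹ := by
  obtain ⟨S, hS1, hS2, hS3⟩ := exists_follows_iff_forall_mem hf (fun k => (x k : Fin d → ℤ))
    (fun k => (x k).2) (Finset.empty_subset D) fun v hv => Or.inr ⟨x.symm ⟨v, hv⟩, by simp⟩
  have hmZ : ∀ k, Measurable fun ω r => Z k r ω := fun k =>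
    measurable_pi_lambda _ (hZ k).measurable
  have hset : {ω | Follows f D ∅ (List.ofFn fun k => ((x k : Fin d → ℤ), fun r => Z k r ω)) D} =
      ⋂ k ∈ (Finset.univ : Finset (Fin n)), (fun ω r => Z k r ω) ⁻¹' S k := by
    ext ω
    simp only [Set.mem_ofPred_eq, hS2, Finset.mem_univ, Set.iInter_true, Set.mem_iInter,
      Set.mem_preimage]
  rw [hset]
  refine ⟨Finset.measurableSet_biInter _ fun k _ => hmZ k (hS1 k), ?_⟩
  rw [Measure.real, hI.measure_inter_preimage_eq_mul Finset.univ fun k _ => hS1 k,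
    ENNReal.toReal_prod]
  rw [Finset.sdiff_empty] at hS3
  rw [← hS3]
  refine Finset.prod_congr rfl fun k _ => ?_
  rw [← (hZ k).hasLaw.map_eq, map_measureReal_apply (hmZ k) (hS1 k), Measure.real]

/-- Wilson's algorithm samples a uniform spanning tree, and the number of spanning trees is given
by the determinant of the Laplacian. -/
theorem wilsonTree_hasLaw [NeZero d] (hZ : ∀ k, IsSimpleRandomWalk P (x k : Fin d → ℤ) (Z k))
    (hI : iIndepFun (fun k ω r => Z k r ω) P) :
    ((spanningTrees (wiredGraph D)).ncard : ℝ) = treeWeight D D ∧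
    HasLaw (fun ω => wilsonTree D (fun k => (x k : Fin d → ℤ)) (fun k r => Z k r ω))
      (uniformOn (spanningTrees (wiredGraph D))) P := by
  let l : Ω → List ((Fin d → ℤ) × (ℕ → Fin d → ℤ)) := fun ω =>
    List.ofFn fun k => ((x k : Fin d → ℤ), fun r => Z k r ω)
  have hgood : ∀ᵐ ω ∂P, ∀ p ∈ l ω,
      p.1 ∈ D ∧ p.2 0 = p.1 ∧ (∃ r, p.2 r ∉ D) ∧ ∀ r, Nbr (p.2 r) (p.2 (r + 1)) := by
    filter_upwards [ae_forall_exists_notMem hZ, ae_all_iff.2 fun k => (hZ k).start,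
      ae_all_iff.2 fun k => (hZ k).ae_nbr] with ω h1 h2 h3 p hp
    obtain ⟨k, rfl⟩ := (List.mem_ofFn' _ _).1 hp
    exact ⟨(x k).2, h2 k, h1 k, h3 k⟩
  have hcov : ∀ ω, ∀ v ∈ D, ∃ p ∈ l ω, p.1 = v := fun ω v hv =>
    ⟨_, (List.mem_ofFn' _ _).2 ⟨x.symm ⟨v, hv⟩, rfl⟩, by simp⟩
  simp only [wilsonTree_eq_wilsonRun]
  have hev : ∀ f, IsParentMap D f → ((fun ω => (wilsonRun D (l ω) ⟨∅, ∅⟩).edges) ⁻¹'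
      {parentEdges D f} : Set Ω) =ᵐ[P] {ω | Follows f D ∅ (l ω) D} := by
    intro f hf
    filter_upwards [hgood] with ω hω
    exact propext (wilsonRun_edges_eq_iff hω (hcov ω) hf)
  have hmem : ∀ᵐ ω ∂P, (wilsonRun D (l ω) ⟨∅, ∅⟩).edges ∈ spanningTrees (wiredGraph D) := by
    filter_upwards [hgood] with ω hω
    obtain ⟨f, hf, hF⟩ := exists_isParentMap_follows hω (hcov ω)
    rw [hF.wilsonRun_edges fun p hp => ⟨(hω p hp).1, (hω p hp).2.1⟩]
    exact parentEdges_mem_spanningTrees hf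
  obtain ⟨h1, h2⟩ := hasLaw_uniformOn (finite_spanningTrees_wiredGraph D) hmem
    (c := ENNReal.ofReal (treeWeight D D)⁻¹)
    (fun T hT => by
      obtain ⟨f, hf, rfl⟩ := exists_isParentMap_of_mem_spanningTrees hT
      exact (measure_follows hf hZ hI).1.nullMeasurableSet.congr (hev f hf).symm)
    (fun T hT => by
      obtain ⟨f, hf, rfl⟩ := exists_isParentMap_of_mem_spanningTrees hT
      rw [measure_congr (hev f hf), ← (measure_follows hf hZ hI).2, ofReal_measureReal])
  refine ⟨?_, h2⟩
  -- The sign comes from probability: a negative value would be truncated to 0 by `ENNReal.ofReal`,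
  -- contradicting total mass one.
  have hpos : 0 ≤ (treeWeight D D)⁻¹ := by
    by_contra! hneg
    rw [ENNReal.ofReal_of_nonpos hneg.le, mul_zero] at h1
    exact zero_ne_one h1
  have h3 := congrArg ENNReal.toReal h1
  rw [ENNReal.toReal_mul, ENNReal.toReal_natCast, ENNReal.toReal_ofReal hpos,
    ENNReal.toReal_one, mul_inv_eq_one₀ (treeWeight_ne_zero subset_rfl)] at h3
  exact h3

/-- Independent simple random walks with given starting points exist. -/
theorem exists_simpleRandomWalks [NeZero d] (x : Fin n → Fin d → ℤ) :
    ∃ (P : Measure (Fin n → ℕ → Fin d → ℤ)) (_ : IsProbabilityMeasure P)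
      (Z : Fin n → ℕ → (Fin n → ℕ → Fin d → ℤ) → (Fin d → ℤ)),
      (∀ k, IsSimpleRandomWalk P (x k) (Z k)) ∧ iIndepFun (fun k ω r => Z k r ω) P := by
  let μ : Measure (ℕ → Fin d → ℤ) := Measure.infinitePi fun _ => stepLaw d
  refine ⟨Measure.infinitePi fun _ => μ, inferInstance, fun k r ω => walkPath (x k) (ω k) r,
    fun k => ?_, iIndepFun_infinitePi fun k => measurable_walkPath (x k)⟩
  have hstep : ∀ r (ω : Fin n → ℕ → Fin d → ℤ),
      walkPath (x k) (ω k) (r + 1) - walkPath (x k) (ω k) r = ω k r := by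
    intro r ω
    simp only [walkPath, Finset.sum_range_succ]
    abel
  have hlaw : (Measure.infinitePi fun _ : Fin n => μ).map (fun ω => ω k) = μ :=
    Measure.infinitePi_map_eval _ k
  have hlaw' : ∀ r, (Measure.infinitePi fun _ : Fin n => μ).map (fun ω => ω k r) = stepLaw d := by
    intro r
    have h := Measure.infinitePi_map_eval (fun _ : ℕ => stepLaw d) r
    change μ.map (fun ω => ω r) = _ at h
    rw [← hlaw, Measure.map_map (measurable_pi_apply r) (measurable_pi_apply k)] at h
    exact h
  refine ⟨fun r => ?_, ?_, ?_, fun r => ?_⟩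
  · exact (measurable_pi_apply r).comp ((measurable_walkPath (x k)).comp (measurable_pi_apply k))
  · exact Filter.Eventually.of_forall fun ω => by simp [walkPath]
  · simp only [hstep]
    rw [iIndepFun_iff_map_fun_eq_infinitePi_map (by fun_prop)]
    simp only [hlaw']
    exact hlaw
  · simp only [hstep]
    exact ⟨Measurable.aemeasurable (by fun_prop), hlaw' r⟩

end Law

end WilsonUST

theorem mainTheorem1 {d : ℕ} (hd : 1 ≤ d) (D : Finset (Fin d → ℤ)) :
    (∀ (x : Fin D.card ≃ D) (Ω : Type*) [MeasurableSpace Ω] (P : Measure Ω)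
        [IsProbabilityMeasure P] (Z : Fin D.card → ℕ → Ω → (Fin d → ℤ)),
      (∀ k, WilsonUST.IsSimpleRandomWalk P (x k : Fin d → ℤ) (Z k)) →
      iIndepFun (fun k ω r => Z k r ω) P →
      (∀ᵐ ω ∂P, ∀ k, ∃ r, Z k r ω ∉ D) ∧
      HasLaw
        (fun ω => WilsonUST.wilsonTree D (fun k => (x k : Fin d → ℤ)) (fun k r => Z k r ω))
        (uniformOn (WilsonUST.spanningTrees (WilsonUST.wiredGraph D))) P) ∧
    ((WilsonUST.spanningTrees (WilsonUST.wiredGraph D)).ncard : ℝ) =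
      (2 * (d : ℝ)) ^ D.card * (-WilsonUST.dirichletLaplacian D).det := by
  have : NeZero d := ⟨by omega⟩
  refine ⟨fun x Ω _ P _ Z hZ hI =>
    ⟨WilsonUST.ae_forall_exists_notMem hZ, (WilsonUST.wilsonTree_hasLaw hZ hI).2⟩, ?_⟩
  -- The count involves no randomness: it is read off from one run of the algorithm, with an
  -- arbitrary ordering and explicitly constructed walks.
  let x : Fin D.card ≃ D := D.equivFin.symm
  obtain ⟨P, _, Z, hZ, hI⟩ :=
    WilsonUST.exists_simpleRandomWalks fun k => (x k : Fin d → ℤ)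
  rw [(WilsonUST.wilsonTree_hasLaw hZ hI).1, WilsonUST.treeWeight,
    WilsonUST.killedMatrix_self]
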